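/- **Setting.** Let $\mathcal X,\mathcal Y,\mathcal A,\mathcal B,\mathcal C$ be finite sets, with output sets $\mathcal A_x\subseteq\mathcal A$ and $\mathcal B_y\subseteq\mathcal B$, a probability distribution $P(x,y,t)$ on $\mathcal X\times\mathcal Y\times\{0,1\}$, a function $\bar c=f(a,b,x,y,t)\in\mathcal C$ (the test data), and a set $S_\Omega$ of probability distributions on $\mathcal C$. For POVMs $\{M_{a|x}\}_{a\in\mathcal A_x}$ on $Q_A$ and $\{N_{b|y}\}_{b\in\mathcal B_y}$ on $Q_B$ (finite-dimensional systems) and a normalized state $\sigma$ on $Q_AQ_BE$, with $E$ finite-dimensional, put $$\mathcal M(\sigma)_{A\bar CXYTE}=\sum_{x,y,t}P(x,y,t)\sum_{a,b}|a,\bar c\rangle\langle a,\bar c|\otimes|x,y,t\rangle\langle x,y,t|\otimes\operatorname{Tr}_{Q_AQ_B}[(M_{a|x}\otimes N_{b|y}\otimes 1_E)\sigma],\qquad \bar c=f(a,b,x,y,t).$$ Let $\mathcal M(\sigma)_{AXYTE\wedge\bar c}$ be its block at $\bar C=\bar c$, let $\mathcal M(\sigma)_{XYTE}$ be its marginal,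 and let $$p(\bar c)=\operatorname{Tr}\big[\mathcal M(\sigma)_{AXYTE\wedge\bar c}^{\alpha}\,(1_A\otimes\mathcal M(\sigma)_{XYTE})^{1-\alpha}\big]$$ (negative powers are those of the pseudo-inverse). For a probability distribution $q$ and a real function $g$ on $\mathcal C$ put $D(q\|g)=\sum_{\bar c}q(\bar c)\log_2\frac{q(\bar c)}{g(\bar c)}$, where a term with $q(\bar c)=0\le g(\bar c)$ is $0$, and a term with $g(\bar c)<0$ or $g(\bar c)=0<q(\bar c)$ is $+\infty$. **Polynomials.** Let $\alpha\in(1,2)$ and $m\ge1$, and let $t_1<\dots<t_m=1$ in $(0,1]$ and $w_1,\dots,w_m>0$ be the nodes and weights of the $m$-point Gauss–Radau quadrature on $[0,1]$ for the weight $s^{\alpha-1}(1-s)^{1-\alpha}$ with fixed node $1$ (exact on polynomials of degree at most $2m-2$). In noncommuting variables $M_{a|x}=M_{a|x}^\dagger$, $N_{b|y}=N_{b|y}^\dagger$, $Z^{x,y,t}_{\bar c,a,i}$, $Z^{x,y,t\,\dagger}_{\bar c,a,i}$ let $$\Pi_{\bar c}=\sum_{x,y,t}P(x,y,t)\sum_{a}\Big(\sum_{b}M_{a|x}N_{b|y}\Big[1+\tfrac{\sin\alpha\pi}{\pi}\sum_{i=1}^m\tfrac{w_i}{t_i}\big(1+Z_i+Z_i^\dagger+(1-t_i)Z_i^\dagger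 Z_i\big)\Big]+\tfrac{\sin\alpha\pi}{\pi}\sum_{i=1}^m w_iZ_iZ_i^\dagger\Big),$$ where $Z_i=Z^{x,y,t}_{\bar c,a,i}$, the sum over $b$ is over $b\in\mathcal B_y$ with $f(a,b,x,y,t)=\bar c$, and the sum over $a$ is over those $a\in\mathcal A_x$ for which such a $b$ exists. The constraints are $M_{a|x}\succeq0$, $N_{b|y}\succeq0$, $\sum_{a\in\mathcal A_x}M_{a|x}=1=\sum_{b\in\mathcal B_y}N_{b|y}$, and that all $M_{a|x}$ commute with all $N_{b|y}$ and that both commute with all $Z$ and $Z^\dagger$. **NPA relaxation.** An NPA relaxation has one real variable $y_v$ for each word $v$ of a finite set $V$ of words. For a polynomial $r$ supported in $V$ write $y(r)$ for the result of replacing each word $v$ by $y_v$. $M(y)$ is the block-diagonal matrix that consists of a moment matrix $(y(u^\dagger v))_{u,v\in W}$ for a finite set $W\ni1$ of words, of a localizing matrix $(y(u^\dagger g v))_{u,v\in W_g}$ for each $g\in\{M_{a|x}\}\cup\{N_{b|y}\}$ and a finite set $W_g$ of words, and of the entries $\pm y(r)$ for finitely many elements $r$ of the two-sided ideal generated by the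 equality constraints. All words that occur in these entries or in some $\Pi_{\bar c}$ lie in $V$. The sets are otherwise arbitrary. The variable of the empty word is called $y_1$, and $N=|V|$. **Theorem.** For all $\alpha\in(1,2)$ and $m\in\mathbb N$, $m\ge 1$, the quadrature above exists, and for every NPA relaxation with variables $\{y_i\}_{i=1}^N$ there are linear functions $f_{\bar c}(y)=\sum_{i=1}^Na_{i,\bar c}\,y_i$, namely $f_{\bar c}(y)=y(\Pi_{\bar c})$, such that the entries of $M(y)$ are linear in the $y_i$ and $$\inf_{Q_A,Q_B,E}\ \inf_{\{M_{a|x}\},\{N_{b|y}\}}\ \inf_{q\in S_\Omega}\ \inf_{\sigma\in S_=(Q_AQ_BE)}\ \frac1{\alpha-1}D(q\|p)\ \ \ge\ \ \inf\Big\{\frac1{\alpha-1}D(q\|f(y))\ :\ y_1=1,\ M(y)\succeq0,\ q\in S_\Omega\Big\}.$$ If $S_\Omega$ is convex, then the program on the right is convex (the epigraph of its objective on its feasible set is convex). -/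

import Mathlib

open scoped ComplexOrder Kronecker

noncomputable section

namespace DIRenyi

/-! ### Classical relative entropy -/

/-- One term `a log₂ (a / b)` of the relative entropy, for `a ≥ 0` and an arbitrary real `b`, with
the closed convention of convex optimization: `0 log (0 / b) = 0` for `b ≥ 0`, and the value `+∞`
where `b < 0`, or `b = 0 < a`. -/
def relEntTerm (a b : ℝ) : EReal :=
  if 0 < a ∧ 0 < b then ((a * Real.logb 2 (a / b) : ℝ) : EReal)
  else if a = 0 ∧ 0 ≤ b then 0
  else ⊤

/-- `D(q ‖ f) = ∑ q(c) log₂ (q(c) / f(c))`; the second argument need not be normalized. -/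
def relEnt {C : Type*} [Fintype C] (q f : C → ℝ) : EReal :=
  ∑ c, relEntTerm (q c) (f c)

/-! ### Gauss–Radau–Jacobi quadrature -/

/-- The `m`-point Gauss–Radau quadrature on `[0,1]` for the Jacobi weight
`t^(α-1) (1-t)^(1-α)` with the endpoint `1` as a node: the nodes lie in `(0,1]`, one of them is `1`,
the weights are positive, and the rule is exact on polynomials of degree at most `2m - 2`. (Nodes
are listed in increasing order, so that they and the weights are determined by `α` and `m ≥ 1`.) -/
structure IsGaussRadauJacobi (α : ℝ) (m : ℕ) (t w : Fin m → ℝ) : Prop where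
  strictMono : StrictMono t
  node_mem : ∀ i, t i ∈ Set.Ioc (0 : ℝ) 1
  endpoint : ∃ i, t i = 1
  weight_pos : ∀ i, 0 < w i
  exact : ∀ p : Polynomial ℝ, p.natDegree ≤ 2 * m - 2 →
    ∫ s in (0 : ℝ)..1, p.eval s * (s ^ (α - 1) * (1 - s) ^ (1 - α)) = ∑ i, w i * p.eval (t i)

/-! ### The protocol, the devices, and the single-round map -/

/-- The classical data of one round: the output sets `A_x` and `B_y` (subsets of common output
alphabets), the distribution `P(x,y,t)` of the inputs and of the test bit, and the function
`c = test (a,b,x,y,t)` that produces the test data. -/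
structure Protocol (X Y A B C : Type*) [Fintype X] [Fintype Y] where
  outA : X → Finset A
  outB : Y → Finset B
  prob : X → Y → Bool → ℝ
  prob_nonneg : ∀ x y t, 0 ≤ prob x y t
  prob_sum : ∑ x, ∑ y, ∑ t, prob x y t = 1
  test : A → B → X → Y → Bool → C

/-- A normalized quantum state. -/
def IsState {n : Type*} [Fintype n] (σ : Matrix n n ℂ) : Prop :=
  σ.PosSemidef ∧ σ.trace = 1

/-- The partial trace over the first tensor factor. -/
def trFst {m n : Type*} [Fintype m] (σ : Matrix (m × n) (m × n) ℂ) : Matrix n n ℂ :=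
  fun e e' => ∑ k, σ (k, e) (k, e')

/-- The real power `ρ^r` of a positive semidefinite matrix by functional calculus. As `0 ^ r = 0`
for `r ≠ 0`, a negative power is a power of the pseudo-inverse. -/
def mpow {n : Type*} [Fintype n] [DecidableEq n] (ρ : Matrix n n ℂ) (r : ℝ) : Matrix n n ℂ :=
  cfc (fun s : ℝ => s ^ r) ρ

section

variable {X Y A B C : Type*} [Fintype X] [Fintype Y] [Fintype A] [Fintype B] [Fintype C]
  [DecidableEq X] [DecidableEq Y] [DecidableEq A] [DecidableEq B] [DecidableEq C]

/-- Two families of POVMs: `{M_{a|x}}` on `Q_A = ℂ^dA` with outcomes in `A_x`, and `{N_{b|y}}` on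
`Q_B = ℂ^dB` with outcomes in `B_y`. -/
structure Device (S : Protocol X Y A B C) (dA dB : ℕ) where
  M : X → A → Matrix (Fin dA) (Fin dA) ℂ
  N : Y → B → Matrix (Fin dB) (Fin dB) ℂ
  M_pos : ∀ x a, (M x a).PosSemidef
  N_pos : ∀ y b, (N y b).PosSemidef
  M_sum : ∀ x, ∑ a ∈ S.outA x, M x a = 1
  N_sum : ∀ y, ∑ b ∈ S.outB y, N y b = 1
  M_zero : ∀ x a, a ∉ S.outA x → M x a = 0
  N_zero : ∀ y b, b ∉ S.outB y → N y b = 0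

/-- The index type of the joint system `Q_A Q_B E`. -/
abbrev Sys (dA dB dE : ℕ) : Type := (Fin dA × Fin dB) × Fin dE

variable {S : Protocol X Y A B C} {dA dB dE : ℕ}

/-- The block of `𝓜(σ)_{A C E | x,y,t}` at the classical values `a`, `c`:
`∑_{b : test(a,b,x,y,t) = c} Tr_{Q_A Q_B}[(M_{a|x} ⊗ N_{b|y} ⊗ 1_E) σ]`. -/
def Device.block (D : Device S dA dB) (σ : Matrix (Sys dA dB dE) (Sys dA dB dE) ℂ)
    (a : A) (c : C) (x : X) (y : Y) (t : Bool) : Matrix (Fin dE) (Fin dE) ℂ :=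
  ∑ b with S.test a b x y t = c,
    trFst (((D.M x a ⊗ₖ D.N y b) ⊗ₖ (1 : Matrix (Fin dE) (Fin dE) ℂ)) * σ)

/-- The output `𝓜(σ)_{A C X Y T E}` of the single-round map, block diagonal in the classical
registers `A, C, X, Y, T`. -/
def Device.out (D : Device S dA dB) (σ : Matrix (Sys dA dB dE) (Sys dA dB dE) ℂ) :
    Matrix (A × C × X × Y × Bool × Fin dE) (A × C × X × Y × Bool × Fin dE) ℂ :=
  fun (a, c, x, y, t, e) (a', c', x', y', t', e') =>
    if a = a' ∧ c = c' ∧ x = x' ∧ y = y' ∧ t = t' then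
      (S.prob x y t : ℂ) * D.block σ a c x y t e e'
    else 0

/-- The partial state `𝓜(σ)_{A X Y T E ∧ c}`. -/
def Device.outAnd (D : Device S dA dB) (σ : Matrix (Sys dA dB dE) (Sys dA dB dE) ℂ) (c : C) :
    Matrix (A × (X × Y × Bool × Fin dE)) (A × (X × Y × Bool × Fin dE)) ℂ :=
  fun (a, r) (a', r') => D.out σ (a, c, r) (a', c, r')

/-- The marginal `𝓜(σ)_{X Y T E}`. -/
def Device.outXYTE (D : Device S dA dB) (σ : Matrix (Sys dA dB dE) (Sys dA dB dE) ℂ) :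
    Matrix (X × Y × Bool × Fin dE) (X × Y × Bool × Fin dE) ℂ :=
  fun r r' => ∑ a, ∑ c, D.out σ (a, c, r) (a, c, r')

/-- `p(c) = Tr[ 𝓜(σ)_{AXYTE ∧ c}^α · (1_A ⊗ 𝓜(σ)_{XYTE})^(1-α) ]` (a real number). -/
def Device.petz (D : Device S dA dB) (σ : Matrix (Sys dA dB dE) (Sys dA dB dE) ℂ) (α : ℝ)
    (c : C) : ℝ :=
  (Matrix.trace (mpow (D.outAnd σ c) α *
    ((1 : Matrix A A ℂ) ⊗ₖ mpow (D.outXYTE σ) (1 - α)))).re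

/-- The device-independent single-round quantity: the infimum of `1/(α-1) · D(q ‖ p)` over all
finite-dimensional systems `Q_A, Q_B, E`, all POVM families, all `q ∈ SΩ`, and all normalized
states `σ` on `Q_A Q_B E`. -/
def singleRoundValue (S : Protocol X Y A B C) (SΩ : Set (C → ℝ)) (α : ℝ) : EReal :=
  ⨅ (dA : ℕ) (dB : ℕ) (dE : ℕ) (D : Device S dA dB) (q ∈ SΩ)
    (σ : Matrix (Sys dA dB dE) (Sys dA dB dE) ℂ) (_ : IsState σ),
    ((1 / (α - 1) : ℝ) : EReal) * relEnt q (D.petz σ α)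

end

/-! ### Noncommutative polynomials -/

/-- The noncommuting variables: the operators `M_{a|x}`, `N_{b|y}`, `Z_{c,a,i}^{x,y,t}` and
`Z_{c,a,i}^{x,y,t †}`. -/
inductive Letter (X Y A B C : Type*) (m : ℕ)
  | M (x : X) (a : A)
  | N (y : Y) (b : B)
  | Z (c : C) (a : A) (x : X) (y : Y) (t : Bool) (i : Fin m)
  | Zdag (c : C) (a : A) (x : X) (y : Y) (t : Bool) (i : Fin m)

/-- The formal adjoint of a letter. -/
def Letter.adj {X Y A B C : Type*} {m : ℕ} : Letter X Y A B C m → Letter X Y A B C m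
  | .M x a => .M x a
  | .N y b => .N y b
  | .Z c a x y t i => .Zdag c a x y t i
  | .Zdag c a x y t i => .Z c a x y t i

/-- Words in the noncommuting variables. -/
abbrev Word (X Y A B C : Type*) (m : ℕ) := FreeMonoid (Letter X Y A B C m)

/-- The formal adjoint of a word: reverse it and take the adjoint of every letter. -/
def wstar {X Y A B C : Type*} {m : ℕ} (v : Word X Y A B C m) : Word X Y A B C m :=
  FreeMonoid.ofList (v.toList.map Letter.adj).reverse

/-- Noncommutative polynomials. All polynomials of the problem have real coefficients. -/
abbrev NCPoly (X Y A B C : Type*) (m : ℕ) := MonoidAlgebra ℝ (Word X Y A B C m)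

/-- A variable, as a polynomial. -/
def var {X Y A B C : Type*} {m : ℕ} (l : Letter X Y A B C m) : NCPoly X Y A B C m :=
  MonoidAlgebra.of ℝ (Word X Y A B C m) (FreeMonoid.of l)

section

variable {X Y A B C : Type*} {m : ℕ}

/-- `P(Z_{c,a,1}^{x,y,t}, …) = 1 + sin(απ)/π ∑ᵢ (wᵢ/tᵢ) (1 + Zᵢ + Zᵢ† + (1 - tᵢ) Zᵢ† Zᵢ)`. -/
def polyP (α : ℝ) (nd w : Fin m → ℝ) (c : C) (a : A) (x : X) (y : Y) (t : Bool) :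
    NCPoly X Y A B C m :=
  1 + (Real.sin (α * Real.pi) / Real.pi) • ∑ i, (w i / nd i) •
    (1 + var (.Z c a x y t i) + var (.Zdag c a x y t i)
      + (1 - nd i) • (var (.Zdag c a x y t i) * var (.Z c a x y t i)))

/-- `Q(Z_{c,a,1}^{x,y,t}, …) = sin(απ)/π ∑ᵢ wᵢ Zᵢ Zᵢ†`. -/
def polyQ (α : ℝ) (w : Fin m → ℝ) (c : C) (a : A) (x : X) (y : Y) (t : Bool) :
    NCPoly X Y A B C m :=
  (Real.sin (α * Real.pi) / Real.pi) • ∑ i, w i •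
    (var (.Z c a x y t i) * var (.Zdag c a x y t i))

end

section

variable {X Y A B C : Type*} [Fintype X] [Fintype Y] [DecidableEq C]

/-- The polynomial that bounds `p(c)`: the sum over `x, y, t` and over those `a ∈ A_x` that can
generate `c`, of
`P(x,y,t) ( ∑_{b ∈ B_y : test(a,b,x,y,t) = c} M_{a|x} N_{b|y} P(Z) + Q(Z) )`. -/
def objective (S : Protocol X Y A B C) (α : ℝ) {m : ℕ} (nd w : Fin m → ℝ) (c : C) :
    NCPoly X Y A B C m :=
  ∑ x, ∑ y, ∑ t, S.prob x y t •
    ∑ a ∈ S.outA x with ∃ b ∈ S.outB y, S.test a b x y t = c,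
      ((∑ b ∈ S.outB y with S.test a b x y t = c,
          var (.M x a) * var (.N y b) * polyP α nd w c a x y t)
        + polyQ α w c a x y t)

/-- The polynomials that the problem constrains to be zero: completeness of the POVMs, absence of
outcomes outside of the output sets, and the commutation relations
`[M, N] = [M, Z] = [M, Z†] = [N, Z] = [N, Z†] = 0`. -/
inductive EqConstraint (S : Protocol X Y A B C) (m : ℕ) : NCPoly X Y A B C m → Prop
  | sumM (x : X) : EqConstraint S m (∑ a ∈ S.outA x, var (.M x a) - 1)
  | sumN (y : Y) : EqConstraint S m (∑ b ∈ S.outB y, var (.N y b) - 1)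
  | outM (x : X) (a : A) (h : a ∉ S.outA x) : EqConstraint S m (var (.M x a))
  | outN (y : Y) (b : B) (h : b ∉ S.outB y) : EqConstraint S m (var (.N y b))
  | commMN (x : X) (a : A) (y : Y) (b : B) :
      EqConstraint S m (var (.M x a) * var (.N y b) - var (.N y b) * var (.M x a))
  | commMZ (x' : X) (a' : A) (c : C) (a : A) (x : X) (y : Y) (t : Bool) (i : Fin m) :
      EqConstraint S m
        (var (.M x' a') * var (.Z c a x y t i) - var (.Z c a x y t i) * var (.M x' a'))
  | commMZdag (x' : X) (a' : A) (c : C) (a : A) (x : X) (y : Y) (t : Bool) (i : Fin m) :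
      EqConstraint S m
        (var (.M x' a') * var (.Zdag c a x y t i) - var (.Zdag c a x y t i) * var (.M x' a'))
  | commNZ (y' : Y) (b' : B) (c : C) (a : A) (x : X) (y : Y) (t : Bool) (i : Fin m) :
      EqConstraint S m
        (var (.N y' b') * var (.Z c a x y t i) - var (.Z c a x y t i) * var (.N y' b'))
  | commNZdag (y' : Y) (b' : B) (c : C) (a : A) (x : X) (y : Y) (t : Bool) (i : Fin m) :
      EqConstraint S m
        (var (.N y' b') * var (.Zdag c a x y t i) - var (.Zdag c a x y t i) * var (.N y' b'))

/-! ### NPA relaxations -/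

/-- The operators that the problem constrains to be positive semidefinite, `M_{a|x}` and
`N_{b|y}`. -/
def posLetter (m : ℕ) : (X × A) ⊕ (Y × B) → Letter X Y A B C m
  | .inl (x, a) => .M x a
  | .inr (y, b) => .N y b

/-- An NPA relaxation of the problem. It is specified by the finite set `mono` of monomials that
have a moment variable, the finite set `basis` of monomials that index the moment matrix, for each
of the constraints `M_{a|x} ⪰ 0`, `N_{b|y} ⪰ 0` the finite set `loc` of monomials that index the
localizing matrix, and a finite set `eqs` of linear equations between moments, each of them the
expansion of an element of the two-sided ideal of the equality constraints. Every moment that is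
used, also by the objective polynomials, has to have a variable. (The relaxation of order `k` has
as `basis` the words of length at most `k`, and as `mono` those of length at most `2k`; the local
bases may be empty and `eqs` may use any part of the ideal, so that sets of monomials other than
the full levels and the elimination of monomials modulo the equality constraints are included.) -/
structure NPARelaxation (S : Protocol X Y A B C) (α : ℝ) {m : ℕ} (nd w : Fin m → ℝ) where
  mono : Finset (Word X Y A B C m)
  basis : Finset (Word X Y A B C m)
  loc : (X × A) ⊕ (Y × B) → Finset (Word X Y A B C m)
  eqs : Finset (NCPoly X Y A B C m)
  one_mem : 1 ∈ basis
  basis_mem : ∀ u ∈ basis, ∀ v ∈ basis, wstar u * v ∈ mono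
  loc_mem : ∀ g, ∀ u ∈ loc g, ∀ v ∈ loc g, wstar u * FreeMonoid.of (posLetter m g) * v ∈ mono
  eqs_mono : ∀ r ∈ eqs, r.coeff.support ⊆ mono
  eqs_ideal : ∀ r ∈ eqs, r ∈ TwoSidedIdeal.span {s | EqConstraint S m s}
  objective_mono : ∀ c, (objective S α nd w c).coeff.support ⊆ mono

namespace NPARelaxation

variable {S : Protocol X Y A B C} {α : ℝ} {m : ℕ} {nd w : Fin m → ℝ}

/-- The index set of the variables `y_1, …, y_N`: one for each monomial. -/
abbrev Idx (R : NPARelaxation S α nd w) : Type _ := {v // v ∈ R.mono}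

/-- The index of the variable of the empty word, which is called `y_1`. -/
def one (R : NPARelaxation S α nd w) : R.Idx :=
  ⟨1, by simpa [wstar] using R.basis_mem 1 R.one_mem 1 R.one_mem⟩

/-- The substitution of the variables `y` for the monomials of a polynomial. -/
def riesz (R : NPARelaxation S α nd w) (y : R.Idx → ℝ) (p : NCPoly X Y A B C m) : ℝ :=
  ∑ v : R.Idx, p.coeff v.1 * y v

variable [DecidableEq X] [DecidableEq Y] [DecidableEq A] [DecidableEq B]

/-- The rows of `M(y)`: those of the moment matrix, of the localizing matrices, and two `1 × 1`
blocks for every equation. -/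
abbrev Row (R : NPARelaxation S α nd w) : Type _ :=
  {v // v ∈ R.basis} ⊕ ((Σ g, {v // v ∈ R.loc g}) ⊕ ({r // r ∈ R.eqs} ⊕ {r // r ∈ R.eqs}))

open Classical in
/-- The matrix `M(y)` of the relaxation, block diagonal with the moment matrix `y(u† v)`, the
localizing matrices `y(u† M_{a|x} v)` and `y(u† N_{b|y} v)`, and for every equation `r = 0` the
`1 × 1` blocks `y(r)` and `-y(r)`. -/
def momentMatrix (R : NPARelaxation S α nd w) (y : R.Idx → ℝ) : Matrix R.Row R.Row ℝ :=
  Matrix.fromBlocks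
    (Matrix.of fun u v => y ⟨wstar u.1 * v.1, R.basis_mem u.1 u.2 v.1 v.2⟩) 0 0
    (Matrix.fromBlocks
      (Matrix.blockDiagonal' fun g => Matrix.of fun u v =>
        y ⟨wstar u.1 * FreeMonoid.of (posLetter m g) * v.1, R.loc_mem g u.1 u.2 v.1 v.2⟩) 0 0
      (Matrix.fromBlocks
        (Matrix.diagonal fun r => R.riesz y r.1) 0 0
        (Matrix.diagonal fun r => - R.riesz y r.1)))

end NPARelaxation

end

/-! ### The convex program -/

/-- The epigraph of the program `min 1/(α-1) · D(q ‖ f(y))` subject to `q ∈ SΩ` and `F y`. -/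
def programEpigraph {C I : Type*} [Fintype C] (SΩ : Set (C → ℝ)) (α : ℝ)
    (F : (I → ℝ) → Prop) (f : C → (I → ℝ) → ℝ) : Set ((C → ℝ) × (I → ℝ) × ℝ) :=
  {z | z.1 ∈ SΩ ∧ F z.2.1 ∧
    ((1 / (α - 1) : ℝ) : EReal) * relEnt z.1 (fun c => f c z.2.1) ≤ (z.2.2 : EReal)}

/-- The value of the program `inf 1/(α-1) · D(q ‖ f(y))` subject to `q ∈ SΩ` and `F y`. -/
def programValue {C I : Type*} [Fintype C] (SΩ : Set (C → ℝ)) (α : ℝ)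
    (F : (I → ℝ) → Prop) (f : C → (I → ℝ) → ℝ) : EReal :=
  ⨅ (q ∈ SΩ) (y : I → ℝ) (_ : F y),
    ((1 / (α - 1) : ℝ) : EReal) * relEnt q (fun c => f c y)

end DIRenyi

end

open scoped ComplexOrder Kronecker

noncomputable section

/-! Put κ = sin(απ)/π, which is negative for α in (1,2). For p, q > 0 and x = p/q one has p^α
q^(1-α) = p x^(α-1), and x^(α-1) - 1 equals -κ times the integral of (x-1)/(s + x(1-s)) against the
Jacobi weight. The Radau rule can only overestimate this integral (`GaussRadau.le_gaussRadau`):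
interpolating at 1 simply and at the other nodes doubly leaves an error of one sign on [0,1]. At a
node t the integrand times -p is the minimum over real z of the quadratic (p(1 + 2z + (1-t)z²) + t q
z²)/t. Evaluating there gives an upper bound of the required form (`exists_le_scalarBound`).

For matrices ρ and τ, eigenbases turn Tr[ρ^α τ^(1-α)] into a sum of scalar expressions weighted by
the squared overlaps of eigenvectors. Operators Z with the scalar optimizers as coefficients in
these bases attain the same sum of bounds, although ρ and τ need not commute
(`exists_le_matrixBound`). Applied to every classical block of the output state, this yields
operators on E for which the expectation of the polynomial Π_c is at least p(c)
(`exists_petz_le_expect`).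

The moments y_v = Re Tr(vσ) of these operators satisfy every NPA relaxation: the moment and
localizing matrices are Gram matrices and the equality constraints hold identically. Since D(q‖·)
decreases when its second argument grows, the same q and these moments give a value of the program
no larger than that of the strategy. Convexity of the program is the joint convexity of (a, b) ↦ a
log(a/b), together with linearity of f and M in y. -/

namespace GaussRadau

/-! ### Orthogonal polynomials and Gauss–Radau quadrature -/

open Polynomial

/-- A linear functional on polynomials that is positive on the nonzero polynomials that are
nonnegative on `[0,1]`. -/
def IsPositive (L : ℝ[X] →ₗ[ℝ] ℝ) : Prop :=
  ∀ p : ℝ[X], p ≠ 0 → (∀ s ∈ Set.Icc (0 : ℝ) 1, 0 ≤ p.eval s) → 0 < L p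

variable {L : ℝ[X] →ₗ[ℝ] ℝ}

/-- The interior Radau nodes are the roots of a polynomial orthogonal for the functional weighted by
1 - s, so that functional has to be positive as well. -/
theorem IsPositive.mul_one_sub (hL : IsPositive L) :
    IsPositive (L ∘ₗ LinearMap.mulLeft ℝ (1 - X)) := by
  intro p hp h
  refine hL _ (mul_ne_zero ?_ hp) fun s hs => ?_
  · intro h0
    have := congrArg (eval 0) h0
    simp at this
  · simpa using mul_nonneg (sub_nonneg.2 hs.2) (h s hs)

/-- Existence of the monic orthogonal polynomial of degree `n`. -/
theorem IsPositive.exists_orthogonal (hL : IsPositive L) (n : ℕ) :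
    ∃ p : ℝ[X], p.Monic ∧ p.natDegree = n ∧ ∀ q : ℝ[X], q.degree < n → L (p * q) = 0 := by
  let F : degreeLT ℝ n →ₗ[ℝ] Module.Dual ℝ (degreeLT ℝ n) :=
    ((LinearMap.mul ℝ ℝ[X]).compr₂ L).domRestrict₁₂ _ _
  have hF : ∀ p q, F p q = L (p.1 * q.1) := fun _ _ => rfl
  -- A kernel element p would satisfy L(p²) = 0, against positivity.
  have hinj : Function.Injective F := by
    rw [injective_iff_map_eq_zero]
    intro p hp
    by_contra h0
    have h1 : (p : ℝ[X]) ≠ 0 := by simpa using h0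
    have := hL (p.1 * p.1) (mul_ne_zero h1 h1) fun s _ => by
      simpa using mul_self_nonneg (p.1.eval s)
    rw [← hF, hp] at this
    simp at this
  have hsurj : Function.Surjective F :=
    (LinearMap.injective_iff_surjective_of_finrank_eq_finrank
      (Subspace.dual_finrank_eq (K := ℝ) (V := degreeLT ℝ n)).symm).1 hinj
  -- p is the orthogonal projection of X^n onto the polynomials of degree less than n.
  obtain ⟨p, hp⟩ := hsurj ((L ∘ₗ LinearMap.mulLeft ℝ (X ^ n)).domRestrict _)
  have hdeg : p.1.degree < n := mem_degreeLT.1 p.2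
  refine ⟨X ^ n - p.1, monic_X_pow_sub hdeg, ?_, fun q hq => ?_⟩
  · apply natDegree_eq_of_degree_eq_some
    rw [degree_sub_eq_left_of_degree_lt (by simpa using hdeg), degree_X_pow]
  · have := congrArg (fun f => f ⟨q, mem_degreeLT.2 hq⟩) hp
    simp only [hF, LinearMap.domRestrict_apply, LinearMap.comp_apply,
      LinearMap.mulLeft_apply] at this
    rw [sub_mul, map_sub, this, sub_self]

/-- An orthogonal polynomial has no nonconstant factor of constant sign on `[0,1]`. -/
theorem IsPositive.natDegree_factor_eq_zero (hL : IsPositive L) {p d h : ℝ[X]} {n : ℕ}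
    (hp0 : p ≠ 0) (hn : p.natDegree = n) (hp : ∀ q : ℝ[X], q.degree < n → L (p * q) = 0)
    (hdh : p = d * h) (hd : ∀ s ∈ Set.Icc (0 : ℝ) 1, 0 ≤ d.eval s) : d.natDegree = 0 := by
  by_contra h0
  have hd0 : d ≠ 0 := by rintro rfl; simp at h0
  have hh0 : h ≠ 0 := by rintro rfl; simp at hdh; exact hp0 hdh
  have hdeg : d.natDegree + h.natDegree = n := by rw [← hn, hdh, natDegree_mul hd0 hh0]
  -- The cofactor h has degree less than n, so L(p h) = 0, while p h = d h² is nonzero and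
  -- nonnegative on [0,1].
  have h1 := hp h (by
    rw [degree_eq_natDegree hh0]
    exact_mod_cast (by omega : h.natDegree < n))
  have h2 := hL (p * h) (mul_ne_zero hp0 hh0) fun s hs => by
    rw [hdh, eval_mul, eval_mul, mul_assoc]
    exact mul_nonneg (hd s hs) (mul_self_nonneg _)
  exact h2.ne' h1

theorem IsPositive.natDegree_factor_eq_zero' (hL : IsPositive L) {p d h : ℝ[X]} {n : ℕ}
    (hp0 : p ≠ 0) (hn : p.natDegree = n) (hp : ∀ q : ℝ[X], q.degree < n → L (p * q) = 0)
    (hdh : p = d * h) (hd : ∀ s ∈ Set.Icc (0 : ℝ) 1, d.eval s ≤ 0) : d.natDegree = 0 := by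
  rw [← natDegree_neg]
  exact hL.natDegree_factor_eq_zero hp0 hn hp (h := -h) (by rw [hdh]; ring)
    fun s hs => by simpa using hd s hs

theorem const_sign_of_roots_eq_zero {g : ℝ[X]} (hg : g ≠ 0) (h : g.roots = 0) :
    (∀ s, 0 ≤ g.eval s) ∨ (∀ s, g.eval s ≤ 0) := by
  by_contra! hc
  obtain ⟨⟨a, ha⟩, b, hb⟩ := hc
  have hmem : (0 : ℝ) ∈ Set.range fun s => g.eval s :=
    mem_range_of_exists_le_of_exists_ge g.continuous ⟨a, ha.le⟩ ⟨b, hb.le⟩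
  obtain ⟨s, hs⟩ := hmem
  have : s ∈ g.roots := (mem_roots hg).2 hs
  simp [h] at this

/-- The roots of an orthogonal polynomial are real, simple and in `(0,1)`. -/
theorem IsPositive.roots_orthogonal (hL : IsPositive L) {p : ℝ[X]} {n : ℕ}
    (hp0 : p ≠ 0) (hn : p.natDegree = n) (hp : ∀ q : ℝ[X], q.degree < n → L (p * q) = 0) :
    p.roots.toFinset.card = n ∧ ∀ z ∈ p.roots, z ∈ Set.Ioo (0 : ℝ) 1 := by
  -- The root-free cofactor g, the square of X - z at a multiple root, and X - z at a root outside
  -- (0,1) have constant sign on [0,1]. The factor lemmas force each of them to be constant.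
  obtain ⟨g, hg, hcard, hroots⟩ := exists_prod_multiset_X_sub_C_mul p
  have hg0 : g ≠ 0 := by rintro rfl; simp at hg; exact hp0 hg.symm
  have hgdeg : g.natDegree = 0 := by
    rcases const_sign_of_roots_eq_zero hg0 hroots with h | h
    · exact hL.natDegree_factor_eq_zero hp0 hn hp (by rw [← hg, mul_comm]) fun s _ => h s
    · exact hL.natDegree_factor_eq_zero' hp0 hn hp (by rw [← hg, mul_comm]) fun s _ => h s
  constructor
  · rw [Multiset.toFinset_card_of_nodup, ← hn, ← hcard, hgdeg, add_zero]
    rw [Multiset.nodup_iff_count_le_one]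
    intro z
    rw [count_roots]
    by_contra! h2
    obtain ⟨h, hh⟩ := (le_rootMultiplicity_iff hp0).1 h2
    have := hL.natDegree_factor_eq_zero hp0 hn hp hh fun s _ => by
      simpa using sq_nonneg (s - z)
    simp at this
  · intro z hz
    obtain ⟨h, hh⟩ := dvd_iff_isRoot.2 ((mem_roots hp0).1 hz)
    by_contra hcon
    rw [Set.mem_Ioo, not_and_or, not_lt, not_lt] at hcon
    rcases hcon with hz0 | hz1
    · have := hL.natDegree_factor_eq_zero hp0 hn hp hh fun s hs => by
        simpa using hz0.trans hs.1
      simp at this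
    · have := hL.natDegree_factor_eq_zero' hp0 hn hp hh fun s hs => by
        simpa using hs.2.trans hz1
      simp at this

/-- Gauss–Radau quadrature with fixed node `1`. -/
theorem IsPositive.exists_gaussRadau (hL : IsPositive L) {m : ℕ} (hm : 1 ≤ m) :
    ∃ t w : Fin m → ℝ, StrictMono t ∧ (∀ i, t i ∈ Set.Ioc (0 : ℝ) 1) ∧ (∃ i, t i = 1) ∧
      (∀ i, 0 < w i) ∧
      ∀ p : ℝ[X], p.natDegree ≤ 2 * m - 2 → L p = ∑ i, w i * p.eval (t i) := by
  -- The nodes are 1 and the m - 1 roots of P; the weights are the values of L on the Lagrange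
  -- basis.
  obtain ⟨P, hmon, hdeg, horth⟩ := hL.mul_one_sub.exists_orthogonal (m - 1)
  have hP0 : P ≠ 0 := hmon.ne_zero
  obtain ⟨hcard, hroots⟩ := hL.mul_one_sub.roots_orthogonal hP0 hdeg horth
  have h1 : (1 : ℝ) ∉ P.roots.toFinset := fun h => by
    simpa using hroots 1 (Multiset.mem_toFinset.1 h)
  have hT : (insert (1 : ℝ) P.roots.toFinset).card = m := by
    rw [Finset.card_insert_of_notMem h1, hcard]; omega
  let t : Fin m → ℝ := (insert (1 : ℝ) P.roots.toFinset).orderEmbOfFin hT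
  have ht : StrictMono t := (Finset.orderEmbOfFin _ hT).strictMono
  have hmem : ∀ i, t i = 1 ∨ t i ∈ P.roots := fun i => by
    rw [← Multiset.mem_toFinset, ← Finset.mem_insert]
    exact Finset.orderEmbOfFin_mem _ hT i
  have hinj : Set.InjOn t (Finset.univ : Finset (Fin m)) := ht.injective.injOn
  let w : Fin m → ℝ := fun i => L (Lagrange.basis Finset.univ t i)
  have hzero : ∀ i, ((1 - X) * P).eval (t i) = 0 := fun i => by
    rcases hmem i with h | h
    · simp [h]
    · have := (mem_roots hP0).1 h
      simp [this.eq_zero]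
  have hlow : ∀ p : ℝ[X], p.degree < m → L p = ∑ i, w i * p.eval (t i) := fun p hp => by
    conv_lhs => rw [Lagrange.eq_interpolate (f := p) (s := Finset.univ) hinj (by simpa using hp)]
    rw [Lagrange.interpolate_apply, map_sum]
    refine Finset.sum_congr rfl fun i _ => ?_
    rw [← smul_eq_C_mul, map_smul, smul_eq_mul, mul_comm]
  have hmonic : ((X - C 1) * P).Monic := (monic_X_sub_C 1).mul hmon
  have hmdeg : ((X - C 1) * P).natDegree = m := by
    rw [(monic_X_sub_C 1).natDegree_mul hmon, hdeg, natDegree_X_sub_C]; omega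
  have hexact : ∀ p : ℝ[X], p.natDegree ≤ 2 * m - 2 → L p = ∑ i, w i * p.eval (t i) := by
    intro p hp
    have hmod := modByMonic_add_div p ((X - C 1) * P)
    set r := p %ₘ ((X - C 1) * P)
    set q := p /ₘ ((X - C 1) * P) with hq
    have hr : r.degree < m := by
      have := degree_modByMonic_lt p hmonic
      rwa [degree_eq_natDegree hmonic.ne_zero, hmdeg] at this
    -- Division by a polynomial of degree m leaves a quotient of degree at most m - 2, to which P is
    -- orthogonal.
    have hqd : q.degree < (m - 1 : ℕ) := by
      by_cases hq0 : q = 0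
      · rw [hq0, degree_zero]; exact WithBot.bot_lt_coe _
      · rw [degree_eq_natDegree hq0, hq, natDegree_divByMonic p hmonic, hmdeg]
        by_cases hpm : p.natDegree < m
        · exfalso
          apply hq0
          rw [hq, divByMonic_eq_zero_iff hmonic, degree_eq_natDegree hmonic.ne_zero, hmdeg]
          exact degree_le_natDegree.trans_lt (by exact_mod_cast hpm)
        · exact_mod_cast (by omega : p.natDegree - m < m - 1)
    have hLq : L ((X - C 1) * P * q) = 0 := by
      have := horth q hqd
      simp only [LinearMap.comp_apply, LinearMap.mulLeft_apply] at this
      rw [← neg_eq_zero, ← map_neg, ← this]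
      congr 1
      simp only [map_one]; ring
    rw [← hmod, map_add, hLq, add_zero, hlow r hr]
    refine Finset.sum_congr rfl fun i _ => ?_
    have : eval (t i) ((X - C 1) * P) = 0 := by
      have := hzero i
      simp only [eval_mul, eval_sub, eval_one, eval_X, eval_C] at this ⊢
      linear_combination -this
    rw [eval_add, eval_mul, this, zero_mul, add_zero]
  refine ⟨t, w, ht, fun i => ?_, ?_, fun i => ?_, hexact⟩
  · rcases hmem i with h | h
    · simp [h]
    · exact ⟨(hroots _ h).1, (hroots _ h).2.le⟩
  · have : (1 : ℝ) ∈ Set.range ((insert (1 : ℝ) P.roots.toFinset).orderEmbOfFin hT) := by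
      rw [Finset.range_orderEmbOfFin]; simp
    exact this
  -- The squared basis polynomial has degree 2m - 2, so the rule is exact on it and its positive
  -- integral is the weight.
  · have hb := Lagrange.basis_ne_zero hinj (Finset.mem_univ i)
    have hpos := hL (Lagrange.basis Finset.univ t i ^ 2) (pow_ne_zero 2 hb) fun s _ => by
      simpa using sq_nonneg _
    rw [hexact _ (by
      rw [natDegree_pow, Lagrange.natDegree_basis hinj (Finset.mem_univ i)]; simp; omega),
      Finset.sum_eq_single i] at hpos
    · simpa [Lagrange.eval_basis_self hinj (Finset.mem_univ i)] using hpos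
    · intro j _ hj
      simp [Lagrange.eval_basis_of_ne hj.symm (Finset.mem_univ j)]
    · simp

/-! ### Beta integrals -/

open Polynomial MeasureTheory Set

theorem ofReal_beta_integrand (u v : ℝ) {s : ℝ} (hs : s ∈ Ioo (0 : ℝ) 1) :
    (s : ℂ) ^ ((u : ℂ) - 1) * (1 - (s : ℂ)) ^ ((v : ℂ) - 1)
      = ((s ^ (u - 1) * (1 - s) ^ (v - 1) : ℝ) : ℂ) := by
  have h : (0 : ℝ) ≤ 1 - s := sub_nonneg.2 hs.2.le
  rw [Complex.ofReal_mul, Complex.ofReal_cpow hs.1.le, Complex.ofReal_cpow h]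
  push_cast
  rfl

theorem integrableOn_beta {u v : ℝ} (hu : 0 < u) (hv : 0 < v) :
    IntegrableOn (fun s : ℝ => s ^ (u - 1) * (1 - s) ^ (v - 1)) (Ioo 0 1) := by
  have h := Complex.betaIntegral_convergent (u := u) (v := v) (by simpa) (by simpa)
  rw [intervalIntegrable_iff_integrableOn_Ioo_of_le zero_le_one] at h
  have h2 : IntegrableOn (fun s : ℝ => ((s ^ (u - 1) * (1 - s) ^ (v - 1) : ℝ) : ℂ)) (Ioo 0 1) :=
    h.congr_fun (fun s hs => ofReal_beta_integrand u v hs) measurableSet_Ioo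
  exact h2.re

theorem setIntegral_beta {u v : ℝ} (hu : 0 < u) (hv : 0 < v) :
    ∫ s in Ioo (0 : ℝ) 1, s ^ (u - 1) * (1 - s) ^ (v - 1) = ProbabilityTheory.beta u v := by
  rw [ProbabilityTheory.beta_eq_betaIntegralReal u v hu hv, Complex.betaIntegral,
    intervalIntegral.integral_of_le zero_le_one, integral_Ioc_eq_integral_Ioo,
    setIntegral_congr_fun measurableSet_Ioo (fun s hs => ofReal_beta_integrand u v hs),
    integral_complex_ofReal, Complex.ofReal_re]

/-- Euler's reflection formula for B(r, 1 - r). -/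
theorem setIntegral_beta_one_sub {r : ℝ} (hr : r ∈ Ioo (0 : ℝ) 1) :
    ∫ s in Ioo (0 : ℝ) 1, s ^ (r - 1) * (1 - s) ^ (-r) = Real.pi / Real.sin (Real.pi * r) := by
  have := setIntegral_beta hr.1 (sub_pos.2 hr.2)
  rw [ProbabilityTheory.beta, Real.Gamma_mul_Gamma_one_sub] at this
  simpa using this

theorem mobius_pos {x s : ℝ} (hx : 0 < x) (hs : s ∈ Ioo (0 : ℝ) 1) : 0 < s + x * (1 - s) :=
  add_pos hs.1 (mul_pos hx (sub_pos.2 hs.2))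

/-- The beta integral after the substitution `s ↦ s / (s + x (1 - s))`. -/
theorem setIntegral_beta_mobius {r x : ℝ} (hr : r ∈ Ioo (0 : ℝ) 1) (hx : 0 < x) :
    ∫ s in Ioo (0 : ℝ) 1, s ^ (r - 1) * (1 - s) ^ (-r) * (x / (s + x * (1 - s)))
      = x ^ r * (Real.pi / Real.sin (Real.pi * r)) := by
  let φ : ℝ → ℝ := fun s => s / (s + x * (1 - s))
  have himage : φ '' Ioo 0 1 = Ioo 0 1 := by
    ext τ
    constructor
    · rintro ⟨s, hs, rfl⟩
      have hu := mobius_pos hx hs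
      refine ⟨div_pos hs.1 hu, (div_lt_one hu).2 ?_⟩
      nlinarith [mul_pos hx (sub_pos.2 hs.2)]
    · intro hτ
      have hd : 0 < 1 - τ + x * τ := by nlinarith [hτ.1, hτ.2, mul_pos hx hτ.1]
      -- The solution s of φ s = τ.
      refine ⟨x * τ / (1 - τ + x * τ), ⟨div_pos (mul_pos hx hτ.1) hd, ?_⟩, ?_⟩
      · rw [div_lt_one hd]; linarith [hτ.2]
      · have : x * τ / (1 - τ + x * τ) + x * (1 - x * τ / (1 - τ + x * τ))
            = x / (1 - τ + x * τ) := by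
          field_simp; ring
        simp only [φ, this]
        field_simp
  have hinj : InjOn φ (Ioo 0 1) := by
    intro s hs s' hs' h
    have hu := mobius_pos hx hs
    have hu' := mobius_pos hx hs'
    simp only [φ] at h
    rw [div_eq_div_iff hu.ne' hu'.ne'] at h
    have : x * (s - s') = 0 := by linear_combination h
    rcases mul_eq_zero.1 this with h | h
    · exact absurd h hx.ne'
    · linarith
  have hderiv : ∀ s ∈ Ioo (0 : ℝ) 1,
      HasDerivWithinAt φ (x / (s + x * (1 - s)) ^ 2) (Ioo 0 1) s := by
    intro s hs
    have hu := mobius_pos hx hs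
    have h1 : HasDerivAt (fun s : ℝ => s + x * (1 - s)) (1 + x * (-1)) s :=
      (hasDerivAt_id s).add (((hasDerivAt_id s).const_sub 1).const_mul x)
    have := ((hasDerivAt_id s).div h1 hu.ne').hasDerivWithinAt (s := Ioo 0 1)
    convert! this using 1
    simp only [id]
    congr 1
    ring
  have key := integral_image_eq_integral_abs_deriv_smul measurableSet_Ioo hderiv hinj
    (fun τ => τ ^ (r - 1) * (1 - τ) ^ (-r))
  rw [himage, setIntegral_beta_one_sub hr] at key
  rw [key, ← integral_const_mul]
  refine setIntegral_congr_fun measurableSet_Ioo fun s hs => ?_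
  have hu := mobius_pos hx hs
  have h1 : 1 - φ s = x * (1 - s) / (s + x * (1 - s)) := by
    simp only [φ]; field_simp; ring
  have h2 : 0 < 1 - s := sub_pos.2 hs.2
  simp only [smul_eq_mul]
  rw [h1, abs_of_pos (by positivity), show φ s = s / (s + x * (1 - s)) from rfl]
  set u := s + x * (1 - s)
  rw [Real.div_rpow hs.1.le hu.le, Real.div_rpow (by positivity) hu.le,
    Real.mul_rpow hx.le h2.le]
  -- The substituted powers contribute u^(1-r) u^r = u, which turns the Jacobian x / u² into x / u.
  have e1 : u ^ (r - 1) * u ^ (-r) = u⁻¹ := by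
    rw [← Real.rpow_add hu, ← Real.rpow_neg_one]; congr 1; ring
  have e2 : x ^ r * x ^ (-r) = 1 := by
    rw [← Real.rpow_add hx, add_neg_cancel, Real.rpow_zero]
  have h3 : u ^ (r - 1) ≠ 0 := (Real.rpow_pos_of_pos hu _).ne'
  have h4 : u ^ (-r) ≠ 0 := (Real.rpow_pos_of_pos hu _).ne'
  have e3 : (u ^ (r - 1))⁻¹ * (u ^ (-r))⁻¹ = u := by rw [← mul_inv, e1, inv_inv]
  calc s ^ (r - 1) * (1 - s) ^ (-r) * (x / u)
      = (x ^ r * x ^ (-r)) * u * (x / u ^ 2) * (s ^ (r - 1) * (1 - s) ^ (-r)) := by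
        rw [e2]; field_simp
    _ = (x ^ r * x ^ (-r)) * ((u ^ (r - 1))⁻¹ * (u ^ (-r))⁻¹) * (x / u ^ 2)
          * (s ^ (r - 1) * (1 - s) ^ (-r)) := by rw [e3]
    _ = _ := by rw [div_eq_mul_inv _ (u ^ (r - 1)), div_eq_mul_inv _ (u ^ (-r))]; ring

/-! ### The Jacobi weight and the one-sided error of its Radau rule -/

/-- The Jacobi weight. -/
def jacobi (α s : ℝ) : ℝ := s ^ (α - 1) * (1 - s) ^ (1 - α)

variable {α : ℝ}

theorem jacobi_pos {s : ℝ} (hs : s ∈ Ioo (0 : ℝ) 1) : 0 < jacobi α s :=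
  mul_pos (Real.rpow_pos_of_pos hs.1 _) (Real.rpow_pos_of_pos (sub_pos.2 hs.2) _)

theorem integrableOn_jacobi (hα : α ∈ Ioo (1 : ℝ) 2) : IntegrableOn (jacobi α) (Ioo 0 1) := by
  have := integrableOn_beta (u := α) (v := 2 - α) (by linarith [hα.1]) (by linarith [hα.2])
  rw [show 2 - α - 1 = 1 - α by ring] at this
  exact this

theorem integrableOn_mul_jacobi (hα : α ∈ Ioo (1 : ℝ) 2) {f : ℝ → ℝ}
    (hf : ContinuousOn f (Icc 0 1)) : IntegrableOn (fun s => f s * jacobi α s) (Ioo 0 1) := by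
  have h := integrableOn_jacobi hα
  rw [← intervalIntegrable_iff_integrableOn_Ioo_of_le zero_le_one] at h ⊢
  exact h.continuousOn_mul (by rwa [uIcc_of_le zero_le_one])

/-- With u = s + x(1-s), s(x-1)/u = x/u - 1. Splitting off one factor s of the weight leaves the
difference of two beta integrals with r = α - 1. -/
theorem setIntegral_jacobi (hα : α ∈ Ioo (1 : ℝ) 2) {x : ℝ} (hx : 0 < x) :
    ∫ s in Ioo (0 : ℝ) 1, (x - 1) / (s + x * (1 - s)) * jacobi α s
      = (x ^ (α - 1) - 1) * (Real.pi / Real.sin (Real.pi * (α - 1))) := by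
  have hr : α - 1 ∈ Ioo (0 : ℝ) 1 := ⟨by linarith [hα.1], by linarith [hα.2]⟩
  have hb : IntegrableOn (fun s : ℝ => s ^ (α - 1 - 1) * (1 - s) ^ (-(α - 1))) (Ioo 0 1) := by
    have := integrableOn_beta hr.1 (sub_pos.2 hr.2)
    rwa [show 1 - (α - 1) - 1 = -(α - 1) by ring] at this
  have hcont : ContinuousOn (fun s : ℝ => x / (s + x * (1 - s))) (Icc 0 1) := by
    refine continuousOn_const.div (by fun_prop) fun s hs => ?_
    rcases eq_or_lt_of_le hs.1 with h | h
    · rw [← h]; simpa using hx.ne'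
    · exact (add_pos_of_pos_of_nonneg h (mul_nonneg hx.le (sub_nonneg.2 hs.2))).ne'
  have hb' : IntegrableOn (fun s : ℝ => s ^ (α - 1 - 1) * (1 - s) ^ (-(α - 1))
      * (x / (s + x * (1 - s)))) (Ioo 0 1) := by
    rw [← intervalIntegrable_iff_integrableOn_Ioo_of_le zero_le_one] at hb ⊢
    exact hb.mul_continuousOn (by rwa [uIcc_of_le zero_le_one])
  rw [sub_mul, one_mul, ← setIntegral_beta_mobius hr hx, ← setIntegral_beta_one_sub hr,
    ← integral_sub hb' hb]
  refine setIntegral_congr_fun measurableSet_Ioo fun s hs => ?_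
  have hu := mobius_pos hx hs
  have e : s ^ (α - 1) = s ^ (α - 1 - 1) * s := by
    rw [← Real.rpow_add_one hs.1.ne']; congr 1; ring
  simp only [jacobi]
  rw [e, show 1 - α = -(α - 1) by ring]
  field_simp
  ring

/-- Integration against the Jacobi weight. -/
def jacobiFunctional (hα : α ∈ Ioo (1 : ℝ) 2) : ℝ[X] →ₗ[ℝ] ℝ where
  toFun p := ∫ s in Ioo (0 : ℝ) 1, p.eval s * jacobi α s
  map_add' p q := by
    rw [← integral_add (integrableOn_mul_jacobi hα p.continuous.continuousOn)
      (integrableOn_mul_jacobi hα q.continuous.continuousOn)]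
    simp [add_mul]
  map_smul' c p := by
    rw [RingHom.id_apply, smul_eq_mul, ← integral_const_mul]
    simp [mul_assoc]

theorem isPositive_jacobiFunctional (hα : α ∈ Ioo (1 : ℝ) 2) :
    IsPositive (jacobiFunctional hα) := by
  intro p hp h
  change 0 < ∫ s in Ioo (0 : ℝ) 1, p.eval s * jacobi α s
  rw [setIntegral_pos_iff_support_of_nonneg_ae _
    (integrableOn_mul_jacobi hα p.continuous.continuousOn)]
  -- A nonzero polynomial vanishes only on a finite set, which is null.
  · have hsub : Ioo (0 : ℝ) 1 \ (p.roots.toFinset : Set ℝ) ⊆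
        (Function.support fun s => p.eval s * jacobi α s) ∩ Ioo 0 1 := by
      rintro s ⟨hs, hr⟩
      refine ⟨mul_ne_zero ?_ (jacobi_pos hs).ne', hs⟩
      intro h0
      exact hr (by simpa [hp] using h0)
    refine lt_of_lt_of_le ?_ (measure_mono hsub)
    rw [measure_sdiff_null (Finset.measure_zero _ _)]
    simp
  · refine (ae_restrict_iff' measurableSet_Ioo).2 (.of_forall fun s hs => ?_)
    exact mul_nonneg (h s ⟨hs.1.le, hs.2.le⟩) (jacobi_pos hs).le

theorem exists_isGaussRadauJacobi (hα : α ∈ Ioo (1 : ℝ) 2) {m : ℕ} (hm : 1 ≤ m) :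
    ∃ t w : Fin m → ℝ, DIRenyi.IsGaussRadauJacobi α m t w := by
  obtain ⟨t, w, h1, h2, h3, h4, h5⟩ := (isPositive_jacobiFunctional hα).exists_gaussRadau hm
  refine ⟨t, w, h1, h2, h3, h4, fun p hp => ?_⟩
  rw [← h5 p hp, intervalIntegral.integral_of_le zero_le_one, integral_Ioc_eq_integral_Ioo]
  rfl

/-- The Gauss–Radau rule overestimates the integral of `(x - 1) / (s + x (1 - s))`. -/
theorem le_gaussRadau (hα : α ∈ Ioo (1 : ℝ) 2) {m : ℕ} (hm : 1 ≤ m) {t w : Fin m → ℝ}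
    (h : DIRenyi.IsGaussRadauJacobi α m t w) {x : ℝ} (hx : 0 < x) :
    (x ^ (α - 1) - 1) * (Real.pi / Real.sin (Real.pi * (α - 1)))
      ≤ ∑ i, w i * ((x - 1) / (t i + x * (1 - t i))) := by
  rcases eq_or_ne x 1 with rfl | hx1
  · simp
  obtain ⟨i₀, hi₀⟩ := h.endpoint
  let P : ℝ[X] := Lagrange.nodal (Finset.univ.erase i₀) t
  have hPdeg : P.natDegree = m - 1 := by simp [P, Lagrange.natDegree_nodal]
  -- ω vanishes at all nodes, to second order at those below 1, and is nonpositive on [0,1].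
  let ω : ℝ[X] := (X - 1) * P ^ 2
  have hωdeg : ω.natDegree = 2 * m - 1 := by
    have hP : P ≠ 0 := Lagrange.nodal_ne_zero
    have h1 : (X - 1 : ℝ[X]) ≠ 0 := by simpa using X_sub_C_ne_zero (1 : ℝ)
    rw [natDegree_mul h1 (pow_ne_zero 2 hP), natDegree_pow, hPdeg,
      show (X - 1 : ℝ[X]) = X - C 1 by simp, natDegree_X_sub_C]
    omega
  have hω : ∀ i, ω.eval (t i) = 0 := fun i => by
    by_cases hi : i = i₀
    · simp [ω, hi, hi₀]
    · simp [ω, P, Lagrange.eval_nodal_at_node (Finset.mem_erase.2 ⟨hi, Finset.mem_univ i⟩)]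
  -- s₀ is the pole of the integrand; it lies outside [0,1].
  set s₀ := x / (x - 1) with hs₀
  have hx1' : x - 1 ≠ 0 := sub_ne_zero.2 hx1
  have hs₀1 : s₀ - 1 = 1 / (x - 1) := by rw [hs₀]; field_simp; ring
  have hs₀mem : ∀ s ∈ Icc (0 : ℝ) 1, s₀ ≠ s := by
    rintro s hs rfl
    have e : s₀ * (x - 1) = x := by rw [hs₀]; field_simp
    rcases lt_or_gt_of_ne hx1 with hlt | hgt
    · nlinarith [hs.1, hs.2]
    · nlinarith [hs.1, hs.2]
  have hP₀ : P.eval s₀ ≠ 0 := by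
    simp only [P, Lagrange.eval_nodal, Finset.prod_ne_zero_iff]
    intro i _
    exact sub_ne_zero.2 (hs₀mem _ ⟨(h.node_mem i).1.le, (h.node_mem i).2⟩)
  have hω₀ : ω.eval s₀ = 1 / (x - 1) * P.eval s₀ ^ 2 := by simp [ω, hs₀1]
  have hω₀' : ω.eval s₀ ≠ 0 := by rw [hω₀]; positivity
  obtain ⟨g, hg⟩ : X - C s₀ ∣ ω - C (ω.eval s₀) := X_sub_C_dvd_sub_C_eval
  have hgdeg : g.natDegree ≤ 2 * m - 2 := by
    have h1 : (ω - C (ω.eval s₀)).natDegree = 2 * m - 1 := by rw [natDegree_sub_C, hωdeg]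
    have hg0 : g ≠ 0 := by
      rintro rfl
      rw [hg, mul_zero, natDegree_zero] at h1
      omega
    rw [hg, natDegree_mul (X_sub_C_ne_zero _) hg0, natDegree_X_sub_C] at h1
    omega
  -- H is the integrand times 1 - ω/ω(s₀). This factor cancels the pole, so H is a polynomial on
  -- which the rule is exact, and it agrees with the integrand at the nodes.
  let H : ℝ[X] := C (ω.eval s₀)⁻¹ * g
  have hHdeg : H.natDegree ≤ 2 * m - 2 := (natDegree_C_mul_le _ _).trans hgdeg
  have hHeval : ∀ s ∈ Icc (0 : ℝ) 1, H.eval s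
      = (x - 1) / (s + x * (1 - s)) * (1 - ω.eval s / ω.eval s₀) := by
    intro s hs
    have e := congrArg (eval s) hg
    simp only [eval_sub, eval_mul, eval_X, eval_C] at e
    have h1 : s - s₀ ≠ 0 := sub_ne_zero.2 (hs₀mem s hs).symm
    have h2 : s + x * (1 - s) = -(s - s₀) * (x - 1) := by rw [hs₀]; field_simp; ring
    have h3 : g.eval s = (ω.eval s - ω.eval s₀) / (s - s₀) := by rw [e]; field_simp
    simp only [H, eval_mul, eval_C, h2, h3]
    field_simp
    ring
  have hnodes : ∀ i, H.eval (t i) = (x - 1) / (t i + x * (1 - t i)) := fun i => by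
    rw [hHeval _ ⟨(h.node_mem i).1.le, (h.node_mem i).2⟩, hω]; simp
  have hex := h.exact H hHdeg
  simp only [hnodes] at hex
  rw [← hex, ← setIntegral_jacobi hα hx, intervalIntegral.integral_of_le zero_le_one,
    integral_Ioc_eq_integral_Ioo]
  refine setIntegral_mono_on (integrableOn_mul_jacobi hα ?_)
    (integrableOn_mul_jacobi hα H.continuous.continuousOn) measurableSet_Ioo fun s hs => ?_
  · refine continuousOn_const.div (by fun_prop) fun s hs => ?_
    rcases eq_or_lt_of_le hs.1 with h | h
    · rw [← h]; simpa using hx.ne'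
    · exact (add_pos_of_pos_of_nonneg h (mul_nonneg hx.le (sub_nonneg.2 hs.2))).ne'
  · refine mul_le_mul_of_nonneg_right ?_ (jacobi_pos hs).le
    rw [hHeval s ⟨hs.1.le, hs.2.le⟩, hω₀]
    have hu := mobius_pos hx hs
    -- H minus the integrand is a nonnegative term: one factor x - 1 comes from the integrand and
    -- the other from ω(s₀), so they combine to a square.
    have e : (x - 1) / (s + x * (1 - s)) * (1 - ω.eval s / (1 / (x - 1) * P.eval s₀ ^ 2))
        = (x - 1) / (s + x * (1 - s))
          + (x - 1) ^ 2 / (s + x * (1 - s)) * ((1 - s) * P.eval s ^ 2 / P.eval s₀ ^ 2) := by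
      simp only [ω, eval_mul, eval_sub, eval_X, eval_one, eval_pow]
      field_simp
      ring
    rw [e]
    have := sub_pos.2 hs.2
    have : 0 ≤ (x - 1) ^ 2 / (s + x * (1 - s)) * ((1 - s) * P.eval s ^ 2 / P.eval s₀ ^ 2) := by
      positivity
    linarith

end GaussRadau

/-! ### The scalar variational bound -/

namespace DIRenyi

set_option linter.unusedSectionVars false

/-- The coefficient `sin(απ)/π`. -/
def sinCoeff (α : ℝ) : ℝ := Real.sin (α * Real.pi) / Real.pi

theorem sinCoeff_neg {α : ℝ} (hα : α ∈ Set.Ioo (1 : ℝ) 2) : sinCoeff α < 0 := by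
  refine div_neg_of_neg_of_pos ?_ Real.pi_pos
  have := Real.sin_pos_of_pos_of_lt_pi (x := (α - 1) * Real.pi)
    (mul_pos (by linarith [hα.1]) Real.pi_pos) (by nlinarith [hα.2, Real.pi_pos])
  rw [sub_mul, one_mul, Real.sin_sub_pi] at this
  linarith

/-- This cancels the constant of the integral representation; it rests on sin(π(α-1)) = -sin(απ). -/
theorem sinCoeff_mul_pi_div {α : ℝ} (hα : α ∈ Set.Ioo (1 : ℝ) 2) :
    sinCoeff α * (Real.pi / Real.sin (Real.pi * (α - 1))) = -1 := by
  have h := sinCoeff_neg hα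
  have h1 : Real.sin (Real.pi * (α - 1)) = -Real.sin (α * Real.pi) := by
    rw [mul_comm, sub_mul, one_mul, Real.sin_sub_pi]
  have h2 : Real.sin (α * Real.pi) ≠ 0 := by
    intro h0
    simp [sinCoeff, h0] at h
  rw [h1, sinCoeff]
  have := Real.pi_ne_zero
  field_simp

/-- The scalar version of the variational bound. -/
def scalarBound {m : ℕ} (α : ℝ) (t w : Fin m → ℝ) (p q : ℝ) (z : Fin m → ℝ) : ℝ :=
  p + sinCoeff α * ∑ i, w i / t i * (p * (1 + 2 * z i + (1 - t i) * z i ^ 2))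
    + sinCoeff α * ∑ i, w i * (q * z i ^ 2)

theorem exists_le_scalarBound {α : ℝ} (hα : α ∈ Set.Ioo (1 : ℝ) 2) {m : ℕ} (hm : 1 ≤ m)
    {t w : Fin m → ℝ} (h : IsGaussRadauJacobi α m t w) {p q : ℝ} (hp : 0 ≤ p) (hq : 0 ≤ q) :
    ∃ z, p ^ α * q ^ (1 - α) ≤ scalarBound α t w p q z := by
  have hκ := sinCoeff_neg hα
  rcases hp.eq_or_lt with rfl | hp
  · refine ⟨0, ?_⟩
    rw [Real.zero_rpow (by linarith [hα.1])]
    simp [scalarBound]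
  rcases hq.eq_or_lt with rfl | hq
  -- For q = 0 the left side is 0, because 0^(1-α) = 0 by convention. At node 1 the term quadratic
  -- in z vanishes, so the bound is affine in that variable with negative slope; a suitable z gives
  -- p(b + |b|) ≥ 0.
  · obtain ⟨i₀, hi₀⟩ := h.endpoint
    set b := 1 + sinCoeff α * ∑ i, w i / t i
    have hw := h.weight_pos i₀
    refine ⟨Pi.single i₀ (|b| / (2 * sinCoeff α * w i₀)), ?_⟩
    rw [Real.zero_rpow (by linarith [hα.1]), mul_zero]
    set c := |b| / (2 * sinCoeff α * w i₀)
    have hc : sinCoeff α * (w i₀ * (2 * c)) = |b| := by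
      have := hκ.ne
      simp only [c]
      field_simp
    have hsum : ∑ i, w i / t i * (p * (1 + 2 * (Pi.single i₀ c : Fin m → ℝ) i
        + (1 - t i) * (Pi.single i₀ c : Fin m → ℝ) i ^ 2))
        = p * (∑ i, w i / t i) + p * (w i₀ * (2 * c)) := by
      have : ∀ i, w i / t i * (p * (1 + 2 * (Pi.single i₀ c : Fin m → ℝ) i
          + (1 - t i) * (Pi.single i₀ c : Fin m → ℝ) i ^ 2))
          = p * (w i / t i) + (Pi.single i₀ (p * (w i₀ * (2 * c))) : Fin m → ℝ) i := by
        intro i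
        by_cases hi : i = i₀
        · subst hi
          simp [hi₀]
          ring
        · simp [Pi.single_eq_of_ne hi]
          ring
      simp only [this, Finset.sum_add_distrib, ← Finset.mul_sum, Finset.sum_pi_single',
        Finset.mem_univ, if_true]
    rw [scalarBound, hsum]
    have : p + sinCoeff α * (p * (∑ i, w i / t i) + p * (w i₀ * (2 * c)))
        + sinCoeff α * ∑ i, w i * (0 * (Pi.single i₀ c : Fin m → ℝ) i ^ 2) = p * (b + |b|) := by
      rw [← hc]
      simp [b]
      ring
    rw [this]
    exact mul_nonneg hp.le (by linarith [neg_abs_le b])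
  · have hD : ∀ i, 0 < p * (1 - t i) + t i * q := fun i =>
      add_pos_of_nonneg_of_pos (mul_nonneg hp.le (sub_nonneg.2 (h.node_mem i).2))
        (mul_pos (h.node_mem i).1 hq)
    -- The minimizer of the quadratic at node t i. Its value reproduces -p times the quadrature
    -- term, and the negative coefficient makes it the best choice of z.
    refine ⟨fun i => -p / (p * (1 - t i) + t i * q), ?_⟩
    have hx : 0 < p / q := div_pos hp hq
    have key := GaussRadau.le_gaussRadau hα hm h hx
    have e : scalarBound α t w p q (fun i => -p / (p * (1 - t i) + t i * q))
        = p - sinCoeff α * p *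
          ∑ i, w i * ((p / q - 1) / (t i + p / q * (1 - t i))) := by
      have hs : ∀ i, w i / t i * (p * (1 + 2 * (-p / (p * (1 - t i) + t i * q))
            + (1 - t i) * (-p / (p * (1 - t i) + t i * q)) ^ 2))
          + w i * (q * (-p / (p * (1 - t i) + t i * q)) ^ 2)
          = -p * (w i * ((p / q - 1) / (t i + p / q * (1 - t i)))) := fun i => by
        have h1 := (hD i).ne'
        have h2 := (h.node_mem i).1.ne'
        have h3 : t i + p / q * (1 - t i) = (p * (1 - t i) + t i * q) / q := by
          field_simp; ring
        rw [h3]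
        field_simp
        ring
      rw [scalarBound, add_assoc, ← mul_add, ← Finset.sum_add_distrib, Finset.sum_congr rfl
        fun i _ => hs i, ← Finset.mul_sum]
      ring
    rw [e]
    have h1 := mul_le_mul_of_nonneg_left key (mul_nonneg (neg_pos.2 hκ).le hp.le)
    have h2 : p ^ α * q ^ (1 - α) = p * (p / q) ^ (α - 1) := by
      rw [Real.div_rpow hp.le hq.le, ← neg_sub α 1, Real.rpow_neg hq.le, div_eq_mul_inv,
        ← mul_assoc, ← Real.rpow_one_add' hp.le (by linarith [hα.1])]
      ring_nf
    have h3 := sinCoeff_mul_pi_div hα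
    have h4 : -sinCoeff α * p * (((p / q) ^ (α - 1) - 1)
        * (Real.pi / Real.sin (Real.pi * (α - 1)))) = p * ((p / q) ^ (α - 1) - 1) := by
      linear_combination -(p * ((p / q) ^ (α - 1) - 1)) * h3
    rw [h4] at h1
    rw [h2]
    linarith

/-! ### The matrix variational bound -/

variable {n : Type*} [Fintype n] [DecidableEq n]

open Matrix

theorem exists_diagonalization {ρ : Matrix n n ℂ} (hρ : ρ.PosSemidef) :
    ∃ (U : Matrix n n ℂ) (p : n → ℝ), Uᴴ * U = 1 ∧ U * Uᴴ = 1 ∧ (∀ i, 0 ≤ p i) ∧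
      ρ = U * diagonal (fun i => (p i : ℂ)) * Uᴴ ∧
      ∀ f : ℝ → ℝ, cfc f ρ = U * diagonal (fun i => (f (p i) : ℂ)) * Uᴴ := by
  refine ⟨hρ.1.eigenvectorUnitary, hρ.1.eigenvalues, ?_, ?_, hρ.eigenvalues_nonneg, ?_, ?_⟩
  · exact Unitary.coe_star_mul_self _
  · exact Unitary.coe_mul_star_self _
  · exact hρ.1.spectral_theorem
  · intro f
    rw [hρ.1.cfc_eq]
    rfl

/-- The matrix version of the variational bound. -/
def matrixBound {m : ℕ} (α : ℝ) (t w : Fin m → ℝ) (ρ τ : Matrix n n ℂ)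
    (Z : Fin m → Matrix n n ℂ) : ℝ :=
  ρ.trace.re
    + sinCoeff α * ∑ i, w i / t i *
      ((1 + Z i + (Z i)ᴴ + ((1 - t i : ℝ) : ℂ) • ((Z i)ᴴ * Z i)) * ρ).trace.re
    + sinCoeff α * ∑ i, w i * (Z i * (Z i)ᴴ * τ).trace.re

/-- With K the overlap matrix of two eigenbases, this reduces traces of two noncommuting operators
to double sums over their eigenvalues. -/
theorem trace_mul_diagonal_mul_conjTranspose_mul (K : Matrix n n ℂ) (p q : n → ℝ) :
    (diagonal (fun i => (p i : ℂ)) * Kᴴ * diagonal (fun j => (q j : ℂ)) * K).trace.re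
      = ∑ i, ∑ j, p i * q j * Complex.normSq (K j i) := by
  rw [trace, Complex.re_sum]
  refine Finset.sum_congr rfl fun i _ => ?_
  rw [diag_apply, mul_apply, Complex.re_sum]
  refine Finset.sum_congr rfl fun j _ => ?_
  rw [mul_diagonal, diagonal_mul, conjTranspose_apply,
    show (p i : ℂ) * star (K j i) * (q j) * K j i
      = ((p i * q j * Complex.normSq (K j i) : ℝ) : ℂ) by
      push_cast [Complex.normSq_eq_conj_mul_self]; simp; ring]
  exact Complex.ofReal_re _

theorem exists_le_matrixBound {α : ℝ} (hα : α ∈ Set.Ioo (1 : ℝ) 2) {m : ℕ} (hm : 1 ≤ m)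
    {t w : Fin m → ℝ} (h : IsGaussRadauJacobi α m t w) {ρ τ : Matrix n n ℂ}
    (hρ : ρ.PosSemidef) (hτ : τ.PosSemidef) :
    ∃ Z, (mpow ρ α * mpow τ (1 - α)).trace.re ≤ matrixBound α t w ρ τ Z := by
  obtain ⟨U, p, hU, hU', hp, eρ, cρ⟩ := exists_diagonalization hρ
  obtain ⟨V, q, hV, hV', hq, eτ, cτ⟩ := exists_diagonalization hτ
  choose z hz using fun i j => exists_le_scalarBound hα hm h (hp i) (hq j)
  set K := Vᴴ * U with hK
  have hKK : Kᴴ * K = 1 := by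
    rw [hK, conjTranspose_mul, conjTranspose_conjTranspose, mul_assoc, ← mul_assoc V, hV', one_mul,
      hU]
  -- In the two eigenbases Z has entries z K. Hence every trace in `matrixBound` carries the common
  -- weight |K j i|², and the inequality holds term by term.
  let Y : Fin m → Matrix n n ℂ := fun k => of fun j i => (z i j k : ℂ) * K j i
  have hpow : (mpow ρ α * mpow τ (1 - α)).trace.re
      = ∑ i, ∑ j, p i ^ α * q j ^ (1 - α) * Complex.normSq (K j i) := by
    rw [mpow, mpow, cρ, cτ, ← trace_mul_diagonal_mul_conjTranspose_mul, hK, conjTranspose_mul,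
      conjTranspose_conjTranspose]
    congr 1
    simp only [mul_assoc]
    rw [trace_mul_comm]
    simp only [mul_assoc]
  have htr : ρ.trace.re = ∑ i, ∑ j, p i * Complex.normSq (K j i) := by
    have := trace_mul_diagonal_mul_conjTranspose_mul K p (fun _ => 1)
    simp only [mul_one] at this
    rw [← this, eρ, trace_mul_comm, ← mul_assoc, hU]
    simp [mul_assoc, hKK]
  have hZρ : ∀ k, (V * Y k * Uᴴ * ρ).trace.re
      = ∑ i, ∑ j, p i * z i j k * Complex.normSq (K j i) := fun k => by
    have e1 : (V * Y k * Uᴴ * ρ).trace = (diagonal (fun i => (p i : ℂ)) * Kᴴ * Y k).trace := by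
      rw [eρ, hK, conjTranspose_mul, conjTranspose_conjTranspose]
      simp only [mul_assoc]
      rw [← mul_assoc Uᴴ U, hU, one_mul, ← mul_assoc, trace_mul_comm]
      simp only [mul_assoc]
    rw [e1, trace, Complex.re_sum]
    refine Finset.sum_congr rfl fun i _ => ?_
    rw [diag_apply, mul_apply, Complex.re_sum]
    refine Finset.sum_congr rfl fun j _ => ?_
    rw [diagonal_mul, conjTranspose_apply, show Y k j i = (z i j k : ℂ) * K j i from rfl,
      show (p i : ℂ) * star (K j i) * ((z i j k : ℂ) * K j i)
        = ((p i * z i j k * Complex.normSq (K j i) : ℝ) : ℂ) by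
        push_cast [Complex.normSq_eq_conj_mul_self]; simp; ring]
    exact Complex.ofReal_re _
  have hY : ∀ i j k, Complex.normSq (Y k j i) = z i j k ^ 2 * Complex.normSq (K j i) :=
    fun i j k => by simp [Y, Complex.normSq_mul, Complex.normSq_ofReal, sq]
  have hZZρ : ∀ k, ((V * Y k * Uᴴ)ᴴ * (V * Y k * Uᴴ) * ρ).trace.re
      = ∑ i, ∑ j, p i * z i j k ^ 2 * Complex.normSq (K j i) := fun k => by
    have := trace_mul_diagonal_mul_conjTranspose_mul (Y k) p (fun _ => 1)
    simp only [mul_one, hY, ← mul_assoc] at this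
    rw [← this, eρ]
    simp only [conjTranspose_mul, conjTranspose_conjTranspose, mul_assoc]
    rw [← mul_assoc Vᴴ V, hV, one_mul, ← mul_assoc Uᴴ U, hU, one_mul, trace_mul_comm]
    simp only [mul_assoc]
    rw [hU, trace_mul_comm (Y k)ᴴ]
    simp only [mul_assoc, Complex.ofReal_one, diagonal_one, one_mul, mul_one]
    rw [trace_mul_comm (Y k)]
    simp only [mul_assoc]
  have hZZτ : ∀ k, ((V * Y k * Uᴴ) * (V * Y k * Uᴴ)ᴴ * τ).trace.re
      = ∑ i, ∑ j, q j * z i j k ^ 2 * Complex.normSq (K j i) := fun k => by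
    have := trace_mul_diagonal_mul_conjTranspose_mul (Y k) (fun _ => 1) q
    simp only [one_mul, hY, ← mul_assoc] at this
    rw [← this, eτ]
    simp only [conjTranspose_mul, conjTranspose_conjTranspose, mul_assoc]
    rw [← mul_assoc Uᴴ U, hU, one_mul, ← mul_assoc Vᴴ V, hV, one_mul, trace_mul_comm]
    simp only [mul_assoc]
    rw [hV, trace_mul_comm]
    simp [mul_assoc]
  -- As ρ is Hermitian, the two traces are complex conjugates; this yields the 2z of the scalar
  -- bound.
  have hZc : ∀ k, ((V * Y k * Uᴴ)ᴴ * ρ).trace.re = (V * Y k * Uᴴ * ρ).trace.re := fun k => by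
    rw [trace_mul_comm, ← hρ.1.eq, ← conjTranspose_mul, trace_conjTranspose, hρ.1.eq]
    simp
  refine ⟨fun k => V * Y k * Uᴴ, ?_⟩
  have hfin : matrixBound α t w ρ τ (fun k => V * Y k * Uᴴ)
      = ∑ i, ∑ j, scalarBound α t w (p i) (q j) (z i j) * Complex.normSq (K j i) := by
    have e1 : ∀ k, ((1 + V * Y k * Uᴴ + (V * Y k * Uᴴ)ᴴ + ((1 - t k : ℝ) : ℂ) •
          ((V * Y k * Uᴴ)ᴴ * (V * Y k * Uᴴ))) * ρ).trace.re
        = ∑ i, ∑ j, p i * (1 + 2 * z i j k + (1 - t k) * z i j k ^ 2)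
          * Complex.normSq (K j i) := fun k => by
      rw [add_mul, add_mul, add_mul, one_mul, Matrix.smul_mul, trace_add, trace_add, trace_add,
        trace_smul, smul_eq_mul, Complex.add_re, Complex.add_re, Complex.add_re,
        Complex.re_ofReal_mul, hZc, hZρ, hZZρ, htr]
      simp only [Finset.mul_sum, ← Finset.sum_add_distrib]
      refine Finset.sum_congr rfl fun i _ => Finset.sum_congr rfl fun j _ => ?_
      ring
    simp only [matrixBound, e1, hZZτ, htr, scalarBound]
    simp only [add_mul _ _ (Complex.normSq _), Finset.sum_add_distrib]
    congr 1
    · congr 1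
      simp only [Finset.mul_sum, Finset.sum_mul]
      rw [Finset.sum_comm]
      refine Finset.sum_congr rfl fun i _ => ?_
      rw [Finset.sum_comm]
      refine Finset.sum_congr rfl fun j _ => Finset.sum_congr rfl fun k _ => ?_
      ring
    · simp only [Finset.mul_sum, Finset.sum_mul]
      rw [Finset.sum_comm]
      refine Finset.sum_congr rfl fun i _ => ?_
      rw [Finset.sum_comm]
      refine Finset.sum_congr rfl fun j _ => Finset.sum_congr rfl fun k _ => ?_
      ring
  rw [hpow, hfin]
  exact Finset.sum_le_sum fun i _ => Finset.sum_le_sum fun j _ =>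
    mul_le_mul_of_nonneg_right (hz i j) (Complex.normSq_nonneg _)

/-! ### Functional calculus and invariant coordinate blocks -/

section Intertwine

variable {n k : Type*} [Fintype n] [DecidableEq n] [Fintype k] [DecidableEq k]

/-- The functional calculus respects intertwining relations. -/
theorem cfc_mul_eq_mul_cfc {A : Matrix n n ℂ} {B : Matrix k k ℂ} (hA : A.IsHermitian)
    (hB : B.IsHermitian) {V : Matrix n k ℂ} (h : A * V = V * B) (f : ℝ → ℝ) :
    cfc f A * V = V * cfc f B := by
  have hU : (hA.eigenvectorUnitary : Matrix n n ℂ)ᴴ * hA.eigenvectorUnitary = 1 :=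
    Unitary.coe_star_mul_self _
  have hU' : (hA.eigenvectorUnitary : Matrix n n ℂ) * (hA.eigenvectorUnitary : Matrix n n ℂ)ᴴ = 1 :=
    Unitary.coe_mul_star_self _
  have hW : (hB.eigenvectorUnitary : Matrix k k ℂ)ᴴ * hB.eigenvectorUnitary = 1 :=
    Unitary.coe_star_mul_self _
  have hW' : (hB.eigenvectorUnitary : Matrix k k ℂ) * (hB.eigenvectorUnitary : Matrix k k ℂ)ᴴ = 1 :=
    Unitary.coe_mul_star_self _
  have eA : A = hA.eigenvectorUnitary * diagonal (fun i => (hA.eigenvalues i : ℂ))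
      * (hA.eigenvectorUnitary : Matrix n n ℂ)ᴴ := hA.spectral_theorem
  have eB : B = hB.eigenvectorUnitary * diagonal (fun i => (hB.eigenvalues i : ℂ))
      * (hB.eigenvectorUnitary : Matrix k k ℂ)ᴴ := hB.spectral_theorem
  have cA : cfc f A = hA.eigenvectorUnitary * diagonal (fun i => (f (hA.eigenvalues i) : ℂ))
      * (hA.eigenvectorUnitary : Matrix n n ℂ)ᴴ := by rw [hA.cfc_eq]; rfl
  have cB : cfc f B = hB.eigenvectorUnitary * diagonal (fun i => (f (hB.eigenvalues i) : ℂ))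
      * (hB.eigenvectorUnitary : Matrix k k ℂ)ᴴ := by rw [hB.cfc_eq]; rfl
  rw [cA, cB]
  generalize hA.eigenvalues = a at *
  generalize hB.eigenvalues = b at *
  generalize (hA.eigenvectorUnitary : Matrix n n ℂ) = U at *
  generalize (hB.eigenvectorUnitary : Matrix k k ℂ) = W at *
  have h1 : diagonal (fun i => (a i : ℂ)) * (Uᴴ * V * W)
      = (Uᴴ * V * W) * diagonal (fun i => (b i : ℂ)) := by
    calc diagonal (fun i => (a i : ℂ)) * (Uᴴ * V * W)
        = (Uᴴ * U) * diagonal (fun i => (a i : ℂ)) * Uᴴ * V * W := by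
          rw [hU, Matrix.one_mul]; simp only [Matrix.mul_assoc]
      _ = Uᴴ * (A * V) * W := by rw [eA]; simp only [Matrix.mul_assoc]
      _ = Uᴴ * V * W * diagonal (fun i => (b i : ℂ)) * (Wᴴ * W) := by
          rw [h, eB]; simp only [Matrix.mul_assoc]
      _ = _ := by rw [hW, Matrix.mul_one]
  -- Where an entry of UᴴVW is nonzero, the two eigenvalues coincide; so any f may be applied to
  -- them.
  have h2 : diagonal (fun i => (f (a i) : ℂ)) * (Uᴴ * V * W)
      = (Uᴴ * V * W) * diagonal (fun i => (f (b i) : ℂ)) := by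
    ext i j
    have h3 := congrFun (congrFun h1 i) j
    rw [diagonal_mul, mul_diagonal] at h3 ⊢
    by_cases h0 : (Uᴴ * V * W) i j = 0
    · rw [h0, mul_zero, zero_mul]
    · rw [mul_comm] at h3
      have : a i = b j := Complex.ofReal_injective (mul_left_cancel₀ h0 h3)
      rw [this, mul_comm]
  calc U * diagonal (fun i => (f (a i) : ℂ)) * Uᴴ * V
      = U * (diagonal (fun i => (f (a i) : ℂ)) * (Uᴴ * V * W)) * Wᴴ := by
        simp only [Matrix.mul_assoc, hW', Matrix.mul_one]
    _ = (U * Uᴴ) * V * (W * diagonal (fun i => (f (b i) : ℂ)) * Wᴴ) := by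
        rw [h2]; simp only [Matrix.mul_assoc]
    _ = _ := by rw [hU', Matrix.one_mul]

/-- The coordinate embedding of index types. -/
def coordEmb (φ : k → n) : Matrix n k ℂ := (1 : Matrix n n ℂ).submatrix id φ

theorem mul_coordEmb_apply (A : Matrix n n ℂ) (φ : k → n) (x : n) (j : k) :
    (A * coordEmb φ) x j = A x (φ j) := by
  simp [coordEmb, mul_apply, one_apply]

theorem coordEmb_mul_apply_self {φ : k → n} (hφ : φ.Injective) (B : Matrix k k ℂ) (i j : k) :
    (coordEmb φ * B) (φ i) j = B i j := by
  simp [coordEmb, mul_apply, one_apply, hφ.eq_iff]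

theorem coordEmb_mul_apply_of_notMem {φ : k → n} (B : Matrix k k ℂ) {x : n}
    (hx : x ∉ Set.range φ) (j : k) : (coordEmb φ * B) x j = 0 := by
  rw [mul_apply]
  refine Finset.sum_eq_zero fun i _ => ?_
  have : x ≠ φ i := fun h => hx ⟨i, h.symm⟩
  simp [coordEmb, one_apply, this]

/-- The hypotheses say that A leaves the coordinate subspace of φ invariant and acts on it as B. -/
theorem mul_coordEmb_eq {φ : k → n} (hφ : φ.Injective) {A : Matrix n n ℂ} {B : Matrix k k ℂ}
    (h1 : ∀ i j, A (φ i) (φ j) = B i j) (h0 : ∀ x j, x ∉ Set.range φ → A x (φ j) = 0) :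
    A * coordEmb φ = coordEmb φ * B := by
  ext x j
  rw [mul_coordEmb_apply]
  by_cases hx : x ∈ Set.range φ
  · obtain ⟨i, rfl⟩ := hx
    rw [coordEmb_mul_apply_self hφ, h1]
  · rw [coordEmb_mul_apply_of_notMem B hx, h0 x j hx]

end Intertwine

theorem exists_eq_conjTranspose_mul_self {n : Type*} [Fintype n] {ρ : Matrix n n ℂ}
    (hρ : ρ.PosSemidef) : ∃ K : Matrix n n ℂ, ρ = Kᴴ * K := by
  classical
  obtain ⟨U, p, -, -, hp, h, -⟩ := exists_diagonalization hρ
  refine ⟨diagonal (fun i => (√(p i) : ℂ)) * Uᴴ, ?_⟩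
  have e : (diagonal (fun i => (√(p i) : ℂ)))ᴴ * diagonal (fun i => (√(p i) : ℂ))
      = diagonal (fun i => (p i : ℂ)) := by
    rw [diagonal_conjTranspose, diagonal_mul_diagonal]
    congr 1
    ext i
    rw [Pi.star_apply, RCLike.star_def, Complex.conj_ofReal, ← Complex.ofReal_mul,
      Real.mul_self_sqrt (hp i)]
  rw [conjTranspose_mul, conjTranspose_conjTranspose, h, ← e]
  simp only [mul_assoc]

/-! ### Partial traces -/

section PartialTrace

variable {m n : Type*} [Fintype m] [Fintype n] [DecidableEq n]

theorem trFst_kronecker_one_mul_comm (G : Matrix m m ℂ) (ρ : Matrix (m × n) (m × n) ℂ) :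
    trFst ((G ⊗ₖ (1 : Matrix n n ℂ)) * ρ) = trFst (ρ * (G ⊗ₖ (1 : Matrix n n ℂ))) := by
  ext e e'
  simp only [trFst, mul_apply, kroneckerMap_apply, Fintype.sum_prod_type, one_apply, mul_ite,
    mul_one, mul_zero, ite_mul, zero_mul, Finset.sum_ite_eq, Finset.sum_ite_eq', Finset.mem_univ,
    if_true]
  rw [Finset.sum_comm]
  exact Finset.sum_congr rfl fun _ _ => Finset.sum_congr rfl fun _ _ => mul_comm _ _

theorem posSemidef_trFst {ρ : Matrix (m × n) (m × n) ℂ} (h : ρ.PosSemidef) :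
    (trFst ρ).PosSemidef := by
  have : trFst ρ = ∑ k, ρ.submatrix (fun e => (k, e)) (fun e => (k, e)) := by
    ext e e'
    simp [trFst, Matrix.sum_apply]
  rw [this]
  exact posSemidef_sum _ fun k _ => h.submatrix _

/-- With G = KᴴK, cyclicity in the traced factor gives the partial trace of (K ⊗ 1) ρ (K ⊗ 1)ᴴ. -/
theorem posSemidef_trFst_kronecker_mul {G : Matrix m m ℂ} {ρ : Matrix (m × n) (m × n) ℂ}
    (hG : G.PosSemidef) (h : ρ.PosSemidef) :
    (trFst ((G ⊗ₖ (1 : Matrix n n ℂ)) * ρ)).PosSemidef := by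
  classical
  obtain ⟨K, rfl⟩ := exists_eq_conjTranspose_mul_self hG
  have e : (Kᴴ * K) ⊗ₖ (1 : Matrix n n ℂ) = (Kᴴ ⊗ₖ 1) * (K ⊗ₖ 1) := by
    rw [← mul_kronecker_mul, one_mul]
  rw [e, mul_assoc, trFst_kronecker_one_mul_comm]
  have := h.mul_mul_conjTranspose_same (K ⊗ₖ (1 : Matrix n n ℂ))
  rw [conjTranspose_kronecker, conjTranspose_one] at this
  exact posSemidef_trFst this

theorem trace_mul_trFst [DecidableEq m] (W : Matrix n n ℂ) (ρ : Matrix (m × n) (m × n) ℂ) :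
    (W * trFst ρ).trace = (((1 : Matrix m m ℂ) ⊗ₖ W) * ρ).trace := by
  simp only [trace, diag_apply, mul_apply, trFst, kroneckerMap_apply, Fintype.sum_prod_type,
    one_apply, ite_mul, one_mul, zero_mul, Finset.mul_sum]
  simp only [Finset.sum_ite_irrel, Finset.sum_const_zero, Finset.sum_ite_eq, Finset.mem_univ,
    if_true]
  rw [Finset.sum_comm]
  simp_rw [Finset.sum_comm (s := (Finset.univ : Finset n)) (t := (Finset.univ : Finset m))]
  exact Finset.sum_congr rfl fun _ _ => Finset.sum_comm

theorem trace_mul_trFst_kronecker [DecidableEq m] (G : Matrix m m ℂ) (W : Matrix n n ℂ)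
    (ρ : Matrix (m × n) (m × n) ℂ) :
    (W * trFst ((G ⊗ₖ (1 : Matrix n n ℂ)) * ρ)).trace = ((G ⊗ₖ W) * ρ).trace := by
  rw [trace_mul_trFst, ← mul_assoc, ← mul_kronecker_mul, one_mul, mul_one]

theorem trFst_sum {ι : Type*} (s : Finset ι) (ρ : ι → Matrix (m × n) (m × n) ℂ) :
    trFst (∑ i ∈ s, ρ i) = ∑ i ∈ s, trFst (ρ i) := by
  ext e e'
  simp only [trFst, Matrix.sum_apply]
  rw [Finset.sum_comm]

end PartialTrace

/-! ### Decomposition of p(c) over the classical registers -/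

section Blocks

variable {X Y A B C : Type*} [Fintype X] [Fintype Y] [Fintype A] [Fintype B] [Fintype C]
  [DecidableEq X] [DecidableEq Y] [DecidableEq A] [DecidableEq B] [DecidableEq C]
  {S : Protocol X Y A B C} {dA dB dE : ℕ}

theorem Device.posSemidef_block (D : Device S dA dB) {σ : Matrix (Sys dA dB dE) (Sys dA dB dE) ℂ}
    (hσ : σ.PosSemidef) (a : A) (c : C) (x : X) (y : Y) (t : Bool) :
    (D.block σ a c x y t).PosSemidef :=
  posSemidef_sum _ fun b _ => posSemidef_trFst_kronecker_mul
    ((D.M_pos x a).kronecker (D.N_pos y b)) hσ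

theorem Device.sum_M (D : Device S dA dB) (x : X) : ∑ a, D.M x a = 1 := by
  rw [← D.M_sum x]
  exact (Finset.sum_subset (Finset.subset_univ _) fun a _ h => D.M_zero x a h).symm

theorem Device.sum_N (D : Device S dA dB) (y : Y) : ∑ b, D.N y b = 1 := by
  rw [← D.N_sum y]
  exact (Finset.sum_subset (Finset.subset_univ _) fun b _ h => D.N_zero y b h).symm

/-- Every b yields exactly one c, so the sum runs over all outcome pairs and completeness of both
POVMs applies. -/
theorem Device.sum_block (D : Device S dA dB) (σ : Matrix (Sys dA dB dE) (Sys dA dB dE) ℂ)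
    (x : X) (y : Y) (t : Bool) : ∑ a, ∑ c, D.block σ a c x y t = trFst σ := by
  have h1 : ∀ a, ∑ c, D.block σ a c x y t
      = ∑ b, trFst (((D.M x a ⊗ₖ D.N y b) ⊗ₖ (1 : Matrix (Fin dE) (Fin dE) ℂ)) * σ) := fun a => by
    simp only [Device.block]
    exact Finset.sum_fiberwise _ _ _
  simp only [h1, ← trFst_sum, ← Finset.sum_mul]
  congr 1
  have h2 : ∀ a, ∑ b, (D.M x a ⊗ₖ D.N y b) ⊗ₖ (1 : Matrix (Fin dE) (Fin dE) ℂ)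
      = (D.M x a ⊗ₖ (1 : Matrix (Fin dB) (Fin dB) ℂ)) ⊗ₖ 1 := fun a => by
    rw [← D.sum_N y]
    ext ⟨⟨i, j⟩, e⟩ ⟨⟨i', j'⟩, e'⟩
    simp [Matrix.sum_apply, Finset.mul_sum, Finset.sum_mul]
  have h3 : ∑ a, (D.M x a ⊗ₖ (1 : Matrix (Fin dB) (Fin dB) ℂ)) ⊗ₖ (1 : Matrix (Fin dE) (Fin dE) ℂ)
      = ((1 : Matrix (Fin dA) (Fin dA) ℂ) ⊗ₖ (1 : Matrix (Fin dB) (Fin dB) ℂ)) ⊗ₖ 1 := by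
    rw [← D.sum_M x]
    ext ⟨⟨i, j⟩, e⟩ ⟨⟨i', j'⟩, e'⟩
    simp [Matrix.sum_apply, Finset.sum_mul]
  simp only [h2, h3, one_kronecker_one, one_mul]

theorem Device.outXYTE_apply (D : Device S dA dB) (σ : Matrix (Sys dA dB dE) (Sys dA dB dE) ℂ)
    (x x' : X) (y y' : Y) (t t' : Bool) (e e' : Fin dE) :
    D.outXYTE σ (x, y, t, e) (x', y', t', e')
      = if x = x' ∧ y = y' ∧ t = t' then (S.prob x y t : ℂ) * trFst σ e e' else 0 := by
  have : D.outXYTE σ (x, y, t, e) (x', y', t', e') = ∑ a, ∑ c,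
      if a = a ∧ c = c ∧ x = x' ∧ y = y' ∧ t = t' then
      (S.prob x y t : ℂ) * D.block σ a c x y t e e'
    else 0 := rfl
  rw [this]
  split_ifs with h
  · simp only [h, and_self, if_true]
    obtain ⟨rfl, rfl, rfl⟩ := h
    rw [← D.sum_block σ x y t]
    simp [Matrix.sum_apply, Finset.mul_sum]
  · simp [h]

theorem Device.outAnd_apply (D : Device S dA dB) (σ : Matrix (Sys dA dB dE) (Sys dA dB dE) ℂ)
    (c : C) (a a' : A) (x x' : X) (y y' : Y) (t t' : Bool) (e e' : Fin dE) :
    D.outAnd σ c (a, x, y, t, e) (a', x', y', t', e')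
      = if a = a' ∧ x = x' ∧ y = y' ∧ t = t' then
        (S.prob x y t : ℂ) * D.block σ a c x y t e e' else 0 := by
  have : D.outAnd σ c (a, x, y, t, e) (a', x', y', t', e') =
      if a = a' ∧ c = c ∧ x = x' ∧ y = y' ∧ t = t' then
      (S.prob x y t : ℂ) * D.block σ a c x y t e e'
    else 0 := rfl
  rw [this]
  simp

theorem Device.isHermitian_outAnd (D : Device S dA dB)
    {σ : Matrix (Sys dA dB dE) (Sys dA dB dE) ℂ} (hσ : σ.PosSemidef) (c : C) :
    (D.outAnd σ c).IsHermitian := by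
  ext ⟨a, x, y, t, e⟩ ⟨a', x', y', t', e'⟩
  rw [conjTranspose_apply, D.outAnd_apply, D.outAnd_apply]
  by_cases h : a = a' ∧ x = x' ∧ y = y' ∧ t = t'
  · obtain ⟨rfl, rfl, rfl, rfl⟩ := h
    simp only [and_self, if_true, star_mul', (D.posSemidef_block hσ a c x y t).1.apply]
    simp
  · rw [if_neg h, if_neg (fun h' => h ⟨h'.1.symm, h'.2.1.symm, h'.2.2.1.symm, h'.2.2.2.symm⟩),
      star_zero]

theorem Device.isHermitian_outXYTE (D : Device S dA dB)
    {σ : Matrix (Sys dA dB dE) (Sys dA dB dE) ℂ} (hσ : σ.PosSemidef) :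
    (D.outXYTE σ).IsHermitian := by
  ext ⟨x, y, t, e⟩ ⟨x', y', t', e'⟩
  rw [conjTranspose_apply, D.outXYTE_apply, D.outXYTE_apply]
  by_cases h : x = x' ∧ y = y' ∧ t = t'
  · obtain ⟨rfl, rfl, rfl⟩ := h
    simp only [and_self, if_true, star_mul', (posSemidef_trFst hσ).1.apply]
    simp
  · rw [if_neg h, if_neg (fun h' => h ⟨h'.1.symm, h'.2.1.symm, h'.2.2.symm⟩), star_zero]

theorem posSemidef_real_smul {n : Type*} [Fintype n] {ρ : Matrix n n ℂ} (h : ρ.PosSemidef) {r : ℝ}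
    (hr : 0 ≤ r) : ((r : ℂ) • ρ).PosSemidef :=
  h.smul (by exact_mod_cast hr)

/-- `p(c)` as a sum over the classical blocks. -/
theorem Device.petz_eq (D : Device S dA dB) {σ : Matrix (Sys dA dB dE) (Sys dA dB dE) ℂ}
    (hσ : σ.PosSemidef) (α : ℝ) (c : C) :
    D.petz σ α c = ∑ x, ∑ y, ∑ t, ∑ a,
      (mpow ((S.prob x y t : ℂ) • D.block σ a c x y t) α
        * mpow ((S.prob x y t : ℂ) • trFst σ) (1 - α)).trace.re := by
  have hdiag : ∀ (a : A) (x : X) (y : Y) (t : Bool) (e : Fin dE),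
      (mpow (D.outAnd σ c) α * ((1 : Matrix A A ℂ) ⊗ₖ mpow (D.outXYTE σ) (1 - α)))
        (a, x, y, t, e) (a, x, y, t, e)
      = (mpow ((S.prob x y t : ℂ) • D.block σ a c x y t) α
        * mpow ((S.prob x y t : ℂ) • trFst σ) (1 - α)) e e := by
    intro a x y t e
    have hP := S.prob_nonneg x y t
    let φ : Fin dE → X × Y × Bool × Fin dE := fun e => (x, y, t, e)
    let ψ : Fin dE → A × X × Y × Bool × Fin dE := fun e => (a, x, y, t, e)
    have hφ : φ.Injective := fun e e' h => by simpa [φ] using h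
    have hψ : ψ.Injective := fun e e' h => by simpa [ψ] using h
    have h1 : D.outAnd σ c * coordEmb ψ
        = coordEmb ψ * ((S.prob x y t : ℂ) • D.block σ a c x y t) := by
      refine mul_coordEmb_eq hψ (fun i j => ?_) ?_
      · simp [ψ, D.outAnd_apply]
      · rintro ⟨a', x', y', t', e'⟩ j hr
        rw [D.outAnd_apply, if_neg]
        rintro ⟨rfl, rfl, rfl, rfl⟩
        exact hr ⟨e', rfl⟩
    have h2 : D.outXYTE σ * coordEmb φ = coordEmb φ * ((S.prob x y t : ℂ) • trFst σ) := by
      refine mul_coordEmb_eq hφ (fun i j => ?_) ?_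
      · simp [φ, D.outXYTE_apply]
      · rintro ⟨x', y', t', e'⟩ j hr
        rw [D.outXYTE_apply, if_neg]
        rintro ⟨rfl, rfl, rfl⟩
        exact hr ⟨e', rfl⟩
    -- The embedding of a classical block intertwines the full operator with that block, so powers
    -- can be taken blockwise.
    have h1' := cfc_mul_eq_mul_cfc (D.isHermitian_outAnd hσ c)
      (posSemidef_real_smul (D.posSemidef_block hσ a c x y t) hP).1 h1 (fun s => s ^ α)
    have h2' := cfc_mul_eq_mul_cfc (D.isHermitian_outXYTE hσ)
      (posSemidef_real_smul (posSemidef_trFst hσ) hP).1 h2 (fun s => s ^ (1 - α))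
    have h3 : ((1 : Matrix A A ℂ) ⊗ₖ mpow (D.outXYTE σ) (1 - α)) * coordEmb ψ
        = coordEmb ψ * mpow ((S.prob x y t : ℂ) • trFst σ) (1 - α) := by
      refine mul_coordEmb_eq hψ (fun i j => ?_) ?_
      · have := congrFun (congrFun h2' (φ i)) j
        rw [mul_coordEmb_apply, coordEmb_mul_apply_self hφ] at this
        simpa [ψ, kroneckerMap_apply, mpow] using this
      · rintro ⟨a', r⟩ j hr
        rw [kroneckerMap_apply, one_apply]
        split_ifs with h
        · have hr' : r ∉ Set.range φ := by
            rintro ⟨i, rfl⟩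
            exact hr ⟨i, by simp only [ψ, φ]; rw [← show a' = a from h]⟩
          have := congrFun (congrFun h2' r) j
          rw [mul_coordEmb_apply, coordEmb_mul_apply_of_notMem _ hr'] at this
          rw [one_mul]
          exact this
        · rw [zero_mul]
    have h4 : (mpow (D.outAnd σ c) α * ((1 : Matrix A A ℂ) ⊗ₖ mpow (D.outXYTE σ) (1 - α)))
        * coordEmb ψ = coordEmb ψ * (mpow ((S.prob x y t : ℂ) • D.block σ a c x y t) α
          * mpow ((S.prob x y t : ℂ) • trFst σ) (1 - α)) := by
      rw [Matrix.mul_assoc, h3, ← Matrix.mul_assoc, mpow, h1', Matrix.mul_assoc]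
      rfl
    have := congrFun (congrFun h4 (ψ e)) e
    rwa [mul_coordEmb_apply, coordEmb_mul_apply_self hψ] at this
  rw [Device.petz, trace, Fintype.sum_prod_type]
  simp only [Fintype.sum_prod_type, diag_apply, hdiag, Complex.re_sum, trace]
  rw [Finset.sum_comm]
  refine Finset.sum_congr rfl fun x _ => ?_
  rw [Finset.sum_comm]
  refine Finset.sum_congr rfl fun y _ => ?_
  rw [Finset.sum_comm]

end Blocks

/-! ### Real expectations and Gram matrices -/

section Gram

variable {n : Type*} [Fintype n]

/-- The real part of the expectation of `T` in the state `σ`. -/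
def expect (σ : Matrix n n ℂ) : Matrix n n ℂ →ₗ[ℝ] ℝ where
  toFun T := (T * σ).trace.re
  map_add' S T := by rw [add_mul, trace_add, Complex.add_re]
  map_smul' r T := by rw [Matrix.smul_mul, trace_smul, Complex.smul_re]; rfl

theorem expect_apply (σ T : Matrix n n ℂ) : expect σ T = (T * σ).trace.re := rfl

theorem expect_nonneg {σ T : Matrix n n ℂ} (hσ : σ.PosSemidef) (hT : T.PosSemidef) :
    0 ≤ expect σ T := by
  obtain ⟨K, rfl⟩ := exists_eq_conjTranspose_mul_self hσ
  rw [expect_apply, ← mul_assoc, trace_mul_comm, ← mul_assoc]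
  exact (Complex.le_def.1 (hT.mul_mul_conjTranspose_same K).trace_nonneg).1

theorem expect_conjTranspose {σ : Matrix n n ℂ} (hσ : σ.PosSemidef) (T : Matrix n n ℂ) :
    expect σ Tᴴ = expect σ T := by
  rw [expect_apply, trace_mul_comm, ← hσ.1.eq, ← conjTranspose_mul, trace_conjTranspose, hσ.1.eq]
  simp [expect_apply]

/-- The quadratic form at a real vector x is the expectation of TᴴGT for T = ∑ x_u T_u. Taking real
parts keeps the matrix symmetric. -/
theorem posSemidef_gram {ι : Type*} [Fintype ι] {σ G : Matrix n n ℂ} (hσ : σ.PosSemidef)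
    (hG : G.PosSemidef) (T : ι → Matrix n n ℂ) :
    (Matrix.of fun u v => expect σ ((T u)ᴴ * G * T v)).PosSemidef := by
  refine PosSemidef.of_dotProduct_mulVec_nonneg ?_ fun x => ?_
  · ext u v
    rw [conjTranspose_apply, of_apply, of_apply, star_trivial, ← expect_conjTranspose hσ]
    simp [conjTranspose_mul, hG.1.eq, mul_assoc]
  · have h : (∑ u, x u • T u)ᴴ * G * (∑ v, x v • T v)
        = ∑ u, ∑ v, x u • x v • ((T u)ᴴ * G * T v) := by
      simp only [conjTranspose_sum, Finset.sum_mul, Finset.mul_sum, conjTranspose_smul,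
        star_trivial, Matrix.smul_mul, Matrix.mul_smul]
      rw [Finset.sum_comm]
      exact Finset.sum_congr rfl fun u _ => Finset.sum_congr rfl fun v _ => smul_comm _ _ _
    have h2 := expect_nonneg hσ (hG.conjTranspose_mul_mul_same (∑ u, x u • T u))
    rw [h, map_sum] at h2
    simp only [map_sum, map_smul, smul_eq_mul] at h2
    simpa [dotProduct, mulVec, Finset.mul_sum, mul_comm, mul_left_comm] using h2

end Gram

/-! ### Positivity of block diagonal matrices -/

section Blocks

variable {k l : Type*} [Fintype k] [Fintype l]

theorem posSemidef_fromBlocks_zero {P : Matrix k k ℝ} {Q : Matrix l l ℝ} (hP : P.PosSemidef)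
    (hQ : Q.PosSemidef) : (fromBlocks P 0 0 Q).PosSemidef := by
  refine PosSemidef.of_dotProduct_mulVec_nonneg ?_ fun x => ?_
  · rw [IsHermitian, fromBlocks_conjTranspose, hP.1.eq, hQ.1.eq]
    simp
  · have h1 := hP.dotProduct_mulVec_nonneg (x ∘ Sum.inl)
    have h2 := hQ.dotProduct_mulVec_nonneg (x ∘ Sum.inr)
    rw [fromBlocks_mulVec]
    simpa [dotProduct] using add_nonneg h1 h2

theorem posSemidef_blockDiagonal' {o : Type*} [Fintype o] [DecidableEq o] {κ : o → Type*}
    [∀ i, Fintype (κ i)] {P : ∀ i, Matrix (κ i) (κ i) ℝ} (hP : ∀ i, (P i).PosSemidef) :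
    (blockDiagonal' P).PosSemidef := by
  refine PosSemidef.of_dotProduct_mulVec_nonneg ?_ fun x => ?_
  · rw [IsHermitian, blockDiagonal'_conjTranspose]
    congr 1
    ext1 i
    exact (hP i).1.eq
  · have : star x ⬝ᵥ (blockDiagonal' P).mulVec x
        = ∑ i, star (fun j => x ⟨i, j⟩) ⬝ᵥ (P i).mulVec (fun j => x ⟨i, j⟩) := by
      simp only [dotProduct, mulVec, Fintype.sum_sigma]
      refine Finset.sum_congr rfl fun i _ => Finset.sum_congr rfl fun j _ => ?_
      rw [Finset.sum_eq_single i]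
      · simp [blockDiagonal'_apply_eq]
      · intro i' _ hi'
        exact Finset.sum_eq_zero fun j' _ => by
          rw [blockDiagonal'_apply_ne _ _ _ hi'.symm, zero_mul]
      · simp
    rw [this]
    exact Finset.sum_nonneg fun i _ => (hP i).dotProduct_mulVec_nonneg _

end Blocks

/-! ### Evaluation of noncommutative polynomials on a quantum strategy -/

section Rep

variable {X Y A B C : Type*} [Fintype X] [Fintype Y] [Fintype A] [Fintype B] [Fintype C]
  [DecidableEq X] [DecidableEq Y] [DecidableEq A] [DecidableEq B] [DecidableEq C]
  {S : Protocol X Y A B C} {dA dB dE m : ℕ}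

/-- The operator that a letter stands for, given devices and operators `Z` on `E`. -/
def letterRep (D : Device S dA dB)
    (Z : C → A → X → Y → Bool → Fin m → Matrix (Fin dE) (Fin dE) ℂ) :
    Letter X Y A B C m → Matrix (Sys dA dB dE) (Sys dA dB dE) ℂ
  | .M x a => (D.M x a ⊗ₖ 1) ⊗ₖ 1
  | .N y b => (1 ⊗ₖ D.N y b) ⊗ₖ 1
  | .Z c a x y t i => 1 ⊗ₖ Z c a x y t i
  | .Zdag c a x y t i => 1 ⊗ₖ (Z c a x y t i)ᴴ

/-- The operator that a word stands for. -/
def wordRep (D : Device S dA dB)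
    (Z : C → A → X → Y → Bool → Fin m → Matrix (Fin dE) (Fin dE) ℂ) :
    Word X Y A B C m →* Matrix (Sys dA dB dE) (Sys dA dB dE) ℂ :=
  FreeMonoid.lift (letterRep D Z)

/-- The operator that a polynomial stands for. -/
def polyRep (D : Device S dA dB)
    (Z : C → A → X → Y → Bool → Fin m → Matrix (Fin dE) (Fin dE) ℂ) :
    NCPoly X Y A B C m →ₐ[ℝ] Matrix (Sys dA dB dE) (Sys dA dB dE) ℂ :=
  MonoidAlgebra.lift ℝ _ _ (wordRep D Z)

variable (D : Device S dA dB) (Z : C → A → X → Y → Bool → Fin m → Matrix (Fin dE) (Fin dE) ℂ)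

theorem polyRep_var (l : Letter X Y A B C m) : polyRep D Z (var l) = letterRep D Z l := by
  rw [polyRep, var, MonoidAlgebra.lift_of, wordRep, FreeMonoid.lift_eval_of]

theorem letterRep_adj (l : Letter X Y A B C m) :
    letterRep D Z l.adj = (letterRep D Z l)ᴴ := by
  cases l <;> simp [letterRep, Letter.adj, conjTranspose_kronecker, (D.M_pos _ _).1.eq,
    (D.N_pos _ _).1.eq]

theorem wordRep_wstar (v : Word X Y A B C m) : wordRep D Z (wstar v) = (wordRep D Z v)ᴴ := by
  induction v using FreeMonoid.recOn with
  | one => simp [wstar]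
  | of_mul l v ih =>
    have : wstar (FreeMonoid.of l * v) = wstar v * FreeMonoid.of l.adj := by
      simp [wstar, FreeMonoid.ofList_append]
    rw [this, map_mul, map_mul, conjTranspose_mul, ih]
    simp [wordRep, letterRep_adj]

theorem posSemidef_letterRep_posLetter (g : (X × A) ⊕ (Y × B)) :
    (letterRep D Z (posLetter m g)).PosSemidef := by
  rcases g with ⟨x, a⟩ | ⟨y, b⟩
  · exact ((D.M_pos x a).kronecker PosSemidef.one).kronecker PosSemidef.one
  · exact (PosSemidef.one.kronecker (D.N_pos y b)).kronecker PosSemidef.one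

/-- Operators on `E` as operators on the joint system. -/
def embE (dA dB dE : ℕ) :
    Matrix (Fin dE) (Fin dE) ℂ →ₐ[ℝ] Matrix (Sys dA dB dE) (Sys dA dB dE) ℂ where
  toFun W := 1 ⊗ₖ W
  map_one' := one_kronecker_one
  map_zero' := kronecker_zero _
  map_mul' V W := by rw [← mul_kronecker_mul, one_mul]
  map_add' V W := kronecker_add _ _ _
  commutes' r := by
    rw [Algebra.algebraMap_eq_smul_one, Algebra.algebraMap_eq_smul_one, kronecker_smul,
      one_kronecker_one]

theorem embE_apply (W : Matrix (Fin dE) (Fin dE) ℂ) : embE dA dB dE W = 1 ⊗ₖ W := rfl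

/-- Operators on `Q_A Q_B` as operators on the joint system. -/
def embAB (dA dB dE : ℕ) : Matrix (Fin dA × Fin dB) (Fin dA × Fin dB) ℂ →ₐ[ℝ]
    Matrix (Sys dA dB dE) (Sys dA dB dE) ℂ where
  toFun W := W ⊗ₖ 1
  map_one' := one_kronecker_one
  map_zero' := zero_kronecker _
  map_mul' V W := by rw [← mul_kronecker_mul, one_mul]
  map_add' V W := add_kronecker _ _ _
  commutes' r := by
    rw [Algebra.algebraMap_eq_smul_one, Algebra.algebraMap_eq_smul_one, smul_kronecker,
      one_kronecker_one]

theorem embAB_apply (W : Matrix (Fin dA × Fin dB) (Fin dA × Fin dB) ℂ) :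
    embAB dA dB dE W = W ⊗ₖ 1 := rfl

theorem embAB_mul_embE (V : Matrix (Fin dA × Fin dB) (Fin dA × Fin dB) ℂ)
    (W : Matrix (Fin dE) (Fin dE) ℂ) : embAB dA dB dE V * embE dA dB dE W = V ⊗ₖ W := by
  rw [embAB_apply, embE_apply, ← mul_kronecker_mul, one_mul, mul_one]

theorem embE_mul_embAB (V : Matrix (Fin dA × Fin dB) (Fin dA × Fin dB) ℂ)
    (W : Matrix (Fin dE) (Fin dE) ℂ) : embE dA dB dE W * embAB dA dB dE V = V ⊗ₖ W := by
  rw [embAB_apply, embE_apply, ← mul_kronecker_mul, one_mul, mul_one]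

theorem letterRep_M (x : X) (a : A) :
    letterRep D Z (.M x a) = embAB dA dB dE (D.M x a ⊗ₖ 1) := rfl

theorem letterRep_N (y : Y) (b : B) :
    letterRep D Z (.N y b) = embAB dA dB dE (1 ⊗ₖ D.N y b) := rfl

theorem letterRep_Z (c : C) (a : A) (x : X) (y : Y) (t : Bool) (i : Fin m) :
    letterRep D Z (.Z c a x y t i) = embE dA dB dE (Z c a x y t i) := rfl

theorem letterRep_Zdag (c : C) (a : A) (x : X) (y : Y) (t : Bool) (i : Fin m) :
    letterRep D Z (.Zdag c a x y t i) = embE dA dB dE (Z c a x y t i)ᴴ := rfl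

/-- The three kinds of letters act on the different tensor factors Q_A, Q_B and E, whence the
commutators vanish; the other relations are those of the POVMs. -/
theorem polyRep_eqConstraint {r : NCPoly X Y A B C m} (h : EqConstraint S m r) :
    polyRep D Z r = 0 := by
  have hc : ∀ V W, embAB dA dB dE V * embE dA dB dE W - embE dA dB dE W * embAB dA dB dE V = 0 :=
    fun V W => by rw [embAB_mul_embE, embE_mul_embAB, sub_self]
  cases h with
  | sumM x =>
    have : ∑ a ∈ S.outA x, D.M x a ⊗ₖ (1 : Matrix (Fin dB) (Fin dB) ℂ) = 1 := by
      rw [← one_kronecker_one, ← D.M_sum x]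
      ext ⟨i, j⟩ ⟨i', j'⟩
      simp [Matrix.sum_apply, Finset.sum_mul]
    simp only [map_sub, map_sum, map_one, polyRep_var, letterRep_M]
    rw [← map_sum, this, map_one, sub_self]
  | sumN y =>
    have : ∑ b ∈ S.outB y, (1 : Matrix (Fin dA) (Fin dA) ℂ) ⊗ₖ D.N y b = 1 := by
      rw [← one_kronecker_one, ← D.N_sum y]
      ext ⟨i, j⟩ ⟨i', j'⟩
      simp [Matrix.sum_apply, Finset.mul_sum]
    simp only [map_sub, map_sum, map_one, polyRep_var, letterRep_N]
    rw [← map_sum, this, map_one, sub_self]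
  | outM x a h => rw [polyRep_var, letterRep_M, D.M_zero x a h, zero_kronecker, map_zero]
  | outN y b h => rw [polyRep_var, letterRep_N, D.N_zero y b h, kronecker_zero, map_zero]
  | commMN x a y b =>
    simp only [map_sub, map_mul, polyRep_var, letterRep_M, letterRep_N]
    rw [← map_mul, ← map_mul, ← mul_kronecker_mul, ← mul_kronecker_mul]
    simp
  | commMZ => simp only [map_sub, map_mul, polyRep_var, letterRep_M, letterRep_Z, hc]
  | commMZdag => simp only [map_sub, map_mul, polyRep_var, letterRep_M, letterRep_Zdag, hc]
  | commNZ => simp only [map_sub, map_mul, polyRep_var, letterRep_N, letterRep_Z, hc]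
  | commNZdag => simp only [map_sub, map_mul, polyRep_var, letterRep_N, letterRep_Zdag, hc]

theorem polyRep_of_mem_span {r : NCPoly X Y A B C m}
    (h : r ∈ TwoSidedIdeal.span {s | EqConstraint S m s}) : polyRep D Z r = 0 := by
  have hle : TwoSidedIdeal.span {s | EqConstraint S m s} ≤ TwoSidedIdeal.ker (polyRep D Z) :=
    TwoSidedIdeal.span_le.2 fun s hs =>
      (TwoSidedIdeal.mem_ker (polyRep D Z)).2 (polyRep_eqConstraint D Z hs)
  exact (TwoSidedIdeal.mem_ker _).1 (hle h)

theorem expect_embAB_mul_embE (σ : Matrix (Sys dA dB dE) (Sys dA dB dE) ℂ)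
    (V : Matrix (Fin dA × Fin dB) (Fin dA × Fin dB) ℂ) (W : Matrix (Fin dE) (Fin dE) ℂ) :
    expect σ (embAB dA dB dE V * embE dA dB dE W)
      = (W * trFst ((V ⊗ₖ (1 : Matrix (Fin dE) (Fin dE) ℂ)) * σ)).trace.re := by
  rw [embAB_mul_embE, expect_apply, trace_mul_trFst_kronecker]

theorem expect_embE (σ : Matrix (Sys dA dB dE) (Sys dA dB dE) ℂ)
    (W : Matrix (Fin dE) (Fin dE) ℂ) :
    expect σ (embE dA dB dE W) = (W * trFst σ).trace.re := by
  rw [embE_apply, expect_apply, trace_mul_trFst]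

/-- The expectation of one summand of the objective polynomial. -/
theorem expect_polyRep_summand (σ : Matrix (Sys dA dB dE) (Sys dA dB dE) ℂ) (α : ℝ)
    (nd w : Fin m → ℝ) (a : A) (c : C) (x : X) (y : Y) (t : Bool) :
    expect σ (polyRep D Z ((∑ b ∈ S.outB y with S.test a b x y t = c,
          var (.M x a) * var (.N y b) * polyP α nd w c a x y t) + polyQ α w c a x y t))
      = matrixBound α nd w (D.block σ a c x y t) (trFst σ) (Z c a x y t) := by
  obtain ⟨W, hW⟩ : ∃ W, W = 1 + sinCoeff α • ∑ i, (w i / nd i) • (1 + Z c a x y t i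
    + (Z c a x y t i)ᴴ + (1 - nd i) • ((Z c a x y t i)ᴴ * Z c a x y t i)) := ⟨_, rfl⟩
  have hP : polyRep D Z (polyP α nd w c a x y t) = embE dA dB dE W := by
    simp only [hW, polyP, map_add, map_smul, map_sum, map_mul, map_one, polyRep_var, letterRep_Z,
      letterRep_Zdag]
    rfl
  have hQ : polyRep D Z (polyQ α w c a x y t) = embE dA dB dE
      (sinCoeff α • ∑ i, w i • (Z c a x y t i * (Z c a x y t i)ᴴ)) := by
    simp only [polyQ, map_smul, map_sum, map_mul, polyRep_var, letterRep_Z, letterRep_Zdag]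
    rfl
  have hMN : ∀ b, letterRep D Z (.M x a) * letterRep D Z (.N y b)
      = embAB dA dB dE (D.M x a ⊗ₖ D.N y b) := fun b => by
    rw [letterRep_M, letterRep_N, ← map_mul, ← mul_kronecker_mul, one_mul, mul_one]
  have hblock : D.block σ a c x y t = ∑ b ∈ S.outB y with S.test a b x y t = c,
      trFst (((D.M x a ⊗ₖ D.N y b) ⊗ₖ (1 : Matrix (Fin dE) (Fin dE) ℂ)) * σ) := by
    refine (Finset.sum_subset (Finset.filter_subset_filter _ (Finset.subset_univ _))
      fun b hb hb' => ?_).symm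
    have : b ∉ S.outB y := fun h =>
      hb' (Finset.mem_filter.2 ⟨h, (Finset.mem_filter.1 hb).2⟩)
    rw [D.N_zero y b this, kronecker_zero, zero_kronecker, zero_mul]
    ext e e'
    simp [trFst]
  have hsum : ∀ W, ∑ b ∈ S.outB y with S.test a b x y t = c,
      expect σ (embAB dA dB dE (D.M x a ⊗ₖ D.N y b) * embE dA dB dE W)
      = (W * D.block σ a c x y t).trace.re := fun W => by
    simp only [expect_embAB_mul_embE, hblock, Finset.mul_sum, trace_sum, Complex.re_sum]
  simp only [map_add, map_sum, map_mul, polyRep_var, hMN, hP, hQ, hsum, expect_embE]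
  rw [hW, add_mul, one_mul, trace_add, Complex.add_re, matrixBound]
  simp only [Matrix.smul_mul, Finset.sum_mul, trace_smul, trace_sum, Complex.smul_re,
    Complex.re_sum, smul_eq_mul, Complex.coe_smul]

theorem expect_polyRep_objective (σ : Matrix (Sys dA dB dE) (Sys dA dB dE) ℂ) (α : ℝ)
    (nd w : Fin m → ℝ) (c : C) :
    expect σ (polyRep D Z (objective S α nd w c))
      = ∑ x, ∑ y, ∑ t, S.prob x y t *
        ∑ a ∈ S.outA x with ∃ b ∈ S.outB y, S.test a b x y t = c,
          matrixBound α nd w (D.block σ a c x y t) (trFst σ) (Z c a x y t) := by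
  simp only [← expect_polyRep_summand, ← map_sum, ← smul_eq_mul, ← map_smul]
  rfl

/-- Homogeneity of degree one brings P(x,y,t) in front even though Z is chosen for the rescaled
operators. -/
theorem matrixBound_smul {n : Type*} [Fintype n] [DecidableEq n] (α : ℝ) (nd w : Fin m → ℝ)
    (ρ τ : Matrix n n ℂ) (Z : Fin m → Matrix n n ℂ) (r : ℝ) :
    matrixBound α nd w ((r : ℂ) • ρ) ((r : ℂ) • τ) Z = r * matrixBound α nd w ρ τ Z := by
  simp only [matrixBound, Matrix.mul_smul, trace_smul, smul_eq_mul, Complex.re_ofReal_mul, mul_add,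
    Finset.mul_sum]
  congr 1
  · congr 1
    exact Finset.sum_congr rfl fun i _ => by ring
  · exact Finset.sum_congr rfl fun i _ => by ring

/-- For suitable operators `Z`, the objective polynomials bound `p(c)` from above. -/
theorem exists_petz_le_expect (D : Device S dA dB) {σ : Matrix (Sys dA dB dE) (Sys dA dB dE) ℂ}
    (hσ : σ.PosSemidef) {α : ℝ} (hα : α ∈ Set.Ioo (1 : ℝ) 2) (hm : 1 ≤ m) {nd w : Fin m → ℝ}
    (h : IsGaussRadauJacobi α m nd w) :
    ∃ Z : C → A → X → Y → Bool → Fin m → Matrix (Fin dE) (Fin dE) ℂ, ∀ c,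
      D.petz σ α c ≤ expect σ (polyRep D Z (objective S α nd w c)) := by
  choose Z hZ using fun c a x y t => exists_le_matrixBound hα hm h
    (posSemidef_real_smul (D.posSemidef_block hσ a c x y t) (S.prob_nonneg x y t))
    (posSemidef_real_smul (posSemidef_trFst hσ) (S.prob_nonneg x y t))
  refine ⟨Z, fun c => ?_⟩
  rw [D.petz_eq hσ, expect_polyRep_objective]
  refine Finset.sum_le_sum fun x _ => Finset.sum_le_sum fun y _ => Finset.sum_le_sum fun t _ => ?_
  rw [Finset.mul_sum]
  simp only [← matrixBound_smul]
  refine le_trans (le_of_eq ?_) (Finset.sum_le_sum fun a _ => hZ c a x y t)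
  symm
  -- An outcome a omitted from the objective cannot produce c. Its block is zero and contributes
  -- nothing, as 0^α = 0.
  refine Finset.sum_subset (Finset.subset_univ _) fun a _ ha => ?_
  have hb : D.block σ a c x y t = 0 := by
    rw [Device.block]
    refine Finset.sum_eq_zero fun b hb => ?_
    have h0 : (D.M x a ⊗ₖ D.N y b) = 0 := by
      by_cases haA : a ∈ S.outA x
      · by_cases hbB : b ∈ S.outB y
        · exact absurd (Finset.mem_filter.2 ⟨haA, b, hbB, (Finset.mem_filter.1 hb).2⟩) ha
        · rw [D.N_zero y b hbB, kronecker_zero]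
      · rw [D.M_zero x a haA, zero_kronecker]
    rw [h0, zero_kronecker, zero_mul]
    ext e e'
    simp [trFst]
  have hα0 : α ≠ 0 := by linarith [hα.1]
  rw [hb, smul_zero, mpow, cfc_apply_zero, Real.zero_rpow hα0]
  simp

end Rep

/-! ### Moments of a strategy are feasible for every relaxation -/

section Moments

variable {X Y A B C : Type*} [Fintype X] [Fintype Y] [Fintype A] [Fintype B] [Fintype C]
  [DecidableEq X] [DecidableEq Y] [DecidableEq A] [DecidableEq B] [DecidableEq C]
  {S : Protocol X Y A B C} {dA dB dE m : ℕ} {α : ℝ} {nd w : Fin m → ℝ}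

namespace NPARelaxation

variable (R : NPARelaxation S α nd w) (D : Device S dA dB)
  (Z : C → A → X → Y → Bool → Fin m → Matrix (Fin dE) (Fin dE) ℂ)
  (σ : Matrix (Sys dA dB dE) (Sys dA dB dE) ℂ)

/-- The moments of a quantum strategy. -/
def moments (v : R.Idx) : ℝ := expect σ (wordRep D Z v.1)

theorem riesz_moments {r : NCPoly X Y A B C m} (hr : r.coeff.support ⊆ R.mono) :
    R.riesz (R.moments D Z σ) r = expect σ (polyRep D Z r) := by
  rw [polyRep, MonoidAlgebra.lift_apply, Finsupp.sum, map_sum]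
  simp only [map_smul, smul_eq_mul]
  rw [Finset.sum_subset hr fun v _ hv => by rw [Finsupp.notMem_support_iff.1 hv, zero_mul],
    ← Finset.sum_coe_sort R.mono]
  rfl

theorem moments_one (hσ : IsState σ) : R.moments D Z σ R.one = 1 := by
  change expect σ (wordRep D Z 1) = 1
  rw [map_one, expect_apply, one_mul, hσ.2, Complex.one_re]

/-- The moment and localizing matrices are Gram matrices with G = 1 and G a POVM element; the
equation blocks vanish because evaluation kills the ideal. -/
theorem posSemidef_momentMatrix_moments (hσ : σ.PosSemidef) :
    (R.momentMatrix (R.moments D Z σ)).PosSemidef := by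
  classical
  have heq : ∀ r : {r // r ∈ R.eqs}, R.riesz (R.moments D Z σ) r.1 = 0 := fun r => by
    rw [R.riesz_moments D Z σ (R.eqs_mono r.1 r.2), polyRep_of_mem_span D Z (R.eqs_ideal r.1 r.2),
      map_zero]
  refine posSemidef_fromBlocks_zero ?_ (posSemidef_fromBlocks_zero
    (posSemidef_blockDiagonal' fun g => ?_) (posSemidef_fromBlocks_zero ?_ ?_))
  · have := posSemidef_gram hσ PosSemidef.one fun v : {v // v ∈ R.basis} => wordRep D Z v.1
    convert this using 4 with u v
    change expect σ (wordRep D Z (wstar u.1 * v.1)) = _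
    rw [map_mul (wordRep D Z), wordRep_wstar, mul_one]
  · have := posSemidef_gram hσ (posSemidef_letterRep_posLetter D Z g)
      fun v : {v // v ∈ R.loc g} => wordRep D Z v.1
    convert this using 4 with u v
    change expect σ (wordRep D Z (wstar u.1 * FreeMonoid.of (posLetter m g) * v.1)) = _
    rw [map_mul (wordRep D Z), map_mul (wordRep D Z), wordRep_wstar]
    rfl
  · simp only [heq, diagonal_zero]
    exact PosSemidef.zero
  · simp only [heq, neg_zero, diagonal_zero]
    exact PosSemidef.zero

open Classical in
/-- The coefficient matrices of the linear map `y ↦ M(y)`. -/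
def coeffMatrix (i : R.Idx) : Matrix R.Row R.Row ℝ := R.momentMatrix (Pi.single i 1)

theorem momentMatrix_eq_sum (y : R.Idx → ℝ) :
    R.momentMatrix y = ∑ i, y i • R.coeffMatrix i := by
  classical
  have hy : ∀ v : R.Idx, y v = ∑ i, y i * (Pi.single i 1 : R.Idx → ℝ) v := fun v => by
    simp [Pi.single_apply]
  have hr : ∀ r, R.riesz y r = ∑ i, y i * R.riesz (Pi.single i 1) r := fun r => by
    simp [riesz, Pi.single_apply, mul_comm]
  ext p q
  simp only [Matrix.sum_apply, Matrix.smul_apply, smul_eq_mul, coeffMatrix]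
  rcases p with p | ⟨g, p⟩ | p | p <;> rcases q with q | ⟨g', q⟩ | q | q <;>
    simp only [momentMatrix, fromBlocks_apply₁₁, fromBlocks_apply₁₂, fromBlocks_apply₂₁,
      fromBlocks_apply₂₂, Matrix.zero_apply, mul_zero, Finset.sum_const_zero]
  · exact hy _
  · by_cases hg : g = g'
    · subst hg
      simp only [blockDiagonal'_apply_eq, of_apply]
      exact hy _
    · simp only [blockDiagonal'_apply_ne _ _ _ hg, mul_zero, Finset.sum_const_zero]
  · by_cases hpq : p = q
    · subst hpq
      simp only [diagonal_apply_eq]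
      exact hr _
    · simp only [diagonal_apply_ne _ hpq, mul_zero, Finset.sum_const_zero]
  · by_cases hpq : p = q
    · subst hpq
      simp only [diagonal_apply_eq, mul_neg, Finset.sum_neg_distrib]
      rw [hr]
    · simp only [diagonal_apply_ne _ hpq, mul_zero, Finset.sum_const_zero]

end NPARelaxation

end Moments

/-! ### Monotonicity and joint convexity of the relative entropy -/

section RelEnt

/-- The effective domain of `relEntTerm`. -/
def relEntDom (a b : ℝ) : Prop := (0 < a ∧ 0 < b) ∨ (a = 0 ∧ 0 ≤ b)

theorem relEntTerm_of_dom {a b : ℝ} (h : relEntDom a b) :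
    relEntTerm a b = ((a * Real.logb 2 (a / b) : ℝ) : EReal) := by
  rcases h with h | ⟨rfl, hb⟩
  · rw [relEntTerm, if_pos h]
  · simp [relEntTerm, hb]

theorem relEntTerm_of_not_dom {a b : ℝ} (h : ¬ relEntDom a b) : relEntTerm a b = ⊤ := by
  rw [relEntDom, not_or] at h
  rw [relEntTerm, if_neg h.1, if_neg h.2]

theorem relEntTerm_ne_bot (a b : ℝ) : relEntTerm a b ≠ ⊥ := by
  by_cases h : relEntDom a b
  · rw [relEntTerm_of_dom h]; exact EReal.coe_ne_bot _
  · rw [relEntTerm_of_not_dom h]; exact top_ne_bot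

theorem relEntTerm_anti {a b b' : ℝ} (h : b ≤ b') : relEntTerm a b' ≤ relEntTerm a b := by
  by_cases hd : relEntDom a b
  · rcases hd with ⟨ha, hb⟩ | ⟨rfl, hb⟩
    · have hb' := hb.trans_le h
      rw [relEntTerm_of_dom (.inl ⟨ha, hb⟩), relEntTerm_of_dom (.inl ⟨ha, hb'⟩),
        EReal.coe_le_coe_iff]
      refine mul_le_mul_of_nonneg_left ?_ ha.le
      exact Real.logb_le_logb_of_le one_lt_two (div_pos ha hb')
        (div_le_div_of_nonneg_left ha.le hb h)
    · rw [relEntTerm_of_dom (.inr ⟨rfl, hb⟩), relEntTerm_of_dom (.inr ⟨rfl, hb.trans h⟩)]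
      simp
  · rw [relEntTerm_of_not_dom hd]
    exact le_top

variable {C : Type*} [Fintype C]

theorem relEnt_anti {q f f' : C → ℝ} (h : ∀ c, f c ≤ f' c) : relEnt q f' ≤ relEnt q f :=
  Finset.sum_le_sum fun c _ => relEntTerm_anti (h c)

theorem relEnt_of_dom {q f : C → ℝ} (h : ∀ c, relEntDom (q c) (f c)) :
    relEnt q f = ((∑ c, q c * Real.logb 2 (q c / f c) : ℝ) : EReal) := by
  have hcoe : ∀ g : C → ℝ, ((∑ c, g c : ℝ) : EReal) = ∑ c, (g c : EReal) :=
    fun g => map_sum (⟨⟨Real.toEReal, rfl⟩, EReal.coe_add⟩ : ℝ →+ EReal) g _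
  rw [hcoe]
  exact Finset.sum_congr rfl fun c _ => relEntTerm_of_dom (h c)

theorem relEnt_of_not_dom {q f : C → ℝ} {c : C} (h : ¬ relEntDom (q c) (f c)) :
    relEnt q f = ⊤ := by
  classical
  -- Since ⊤ + ⊥ = ⊥ in `EReal`, the remaining terms must be kept away from ⊥.
  have hbot : ∑ c' ∈ Finset.univ.erase c, relEntTerm (q c') (f c') ≠ ⊥ := by
    refine Finset.sum_induction _ (· ≠ ⊥) (fun a b ha hb => ?_) EReal.zero_ne_bot
      fun c' _ => relEntTerm_ne_bot _ _
    simp [EReal.add_eq_bot_iff, ha, hb]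
  rw [relEnt, ← Finset.add_sum_erase _ _ (Finset.mem_univ c), relEntTerm_of_not_dom h]
  exact EReal.top_add_of_ne_bot hbot

/-- Turns an extended-real epigraph condition into a domain condition and a real inequality, where
convexity can be proved by real arithmetic. -/
theorem mul_relEnt_le_iff {r : ℝ} (hr : 0 < r) (q f : C → ℝ) (z : ℝ) :
    (r : EReal) * relEnt q f ≤ (z : EReal) ↔ (∀ c, relEntDom (q c) (f c)) ∧
      r * ∑ c, q c * Real.logb 2 (q c / f c) ≤ z := by
  by_cases h : ∀ c, relEntDom (q c) (f c)
  · rw [relEnt_of_dom h, ← EReal.coe_mul, EReal.coe_le_coe_iff]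
    simp [h]
  · obtain ⟨c, hc⟩ := not_forall.1 h
    rw [relEnt_of_not_dom hc, EReal.coe_mul_top_of_pos hr]
    simp [h]

theorem relEntDom_convex {a b a' b' l l' : ℝ} (h : relEntDom a b) (h' : relEntDom a' b')
    (hl : 0 ≤ l) (hl' : 0 ≤ l') : relEntDom (l * a + l' * a') (l * b + l' * b') := by
  have ha : 0 ≤ a ∧ 0 ≤ b := by rcases h with h | h; exacts [⟨h.1.le, h.2.le⟩, ⟨h.1.ge, h.2⟩]
  have ha' : 0 ≤ a' ∧ 0 ≤ b' := by rcases h' with h | h; exacts [⟨h.1.le, h.2.le⟩, ⟨h.1.ge, h.2⟩]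
  have h1 := mul_nonneg hl ha.1
  have h2 := mul_nonneg hl ha.2
  have h1' := mul_nonneg hl' ha'.1
  have h2' := mul_nonneg hl' ha'.2
  have key : ∀ {a b l : ℝ}, relEntDom a b → 0 ≤ l → 0 < l * a → 0 < l * b := by
    intro a b l h hl hp
    have hl0 : 0 < l := hl.lt_of_ne (by rintro rfl; simp at hp)
    rcases h with h | h
    · exact mul_pos hl0 h.2
    · simp [h.1] at hp
  rcases h1.eq_or_lt with e | e
  · rcases h1'.eq_or_lt with e' | e'
    · exact .inr ⟨by rw [← e, ← e', add_zero], add_nonneg h2 h2'⟩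
    · exact .inl ⟨add_pos_of_nonneg_of_pos h1 e', add_pos_of_nonneg_of_pos h2 (key h' hl' e')⟩
  · exact .inl ⟨add_pos_of_pos_of_nonneg e h1', add_pos_of_pos_of_nonneg (key h hl e) h2'⟩

/-- The tangent bound behind the log-sum inequality. -/
theorem le_mul_log_div {a b R : ℝ} (h : relEntDom a b) (hR : 0 < R) :
    a * Real.log R + (a - b * R) ≤ a * Real.log (a / b) := by
  rcases h with ⟨ha, hb⟩ | ⟨rfl, hb⟩
  · have h1 := Real.log_le_sub_one_of_pos (div_pos (mul_pos hb hR) ha)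
    have h2 : Real.log (b * R / a) = Real.log R - Real.log (a / b) := by
      rw [Real.log_div (mul_pos hb hR).ne' ha.ne', Real.log_mul hb.ne' hR.ne',
        Real.log_div ha.ne' hb.ne']
      ring
    rw [h2] at h1
    have h3 := mul_le_mul_of_nonneg_left h1 ha.le
    have h4 : a * (b * R / a - 1) = b * R - a := by field_simp
    linarith
  · have := mul_nonneg hb hR.le
    simpa using this

theorem mul_log_div_convex {a b a' b' l l' : ℝ} (h : relEntDom a b) (h' : relEntDom a' b')
    (hl : 0 ≤ l) (hl' : 0 ≤ l') :
    (l * a + l' * a') * Real.log ((l * a + l' * a') / (l * b + l' * b'))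
      ≤ l * (a * Real.log (a / b)) + l' * (a' * Real.log (a' / b')) := by
  rcases relEntDom_convex h h' hl hl' with ⟨hA, hB⟩ | ⟨hA, -⟩
  -- Both tangent bounds are taken at the ratio R of the mixed point, where their linear corrections
  -- add up to zero.
  · have hR := div_pos hA hB
    have h1 := mul_le_mul_of_nonneg_left (le_mul_log_div h hR) hl
    have h2 := mul_le_mul_of_nonneg_left (le_mul_log_div h' hR) hl'
    have h3 : (l * b + l' * b') * ((l * a + l' * a') / (l * b + l' * b')) = l * a + l' * a' := by
      field_simp
    nlinarith
  · have ha : 0 ≤ a := by rcases h with h | h; exacts [h.1.le, h.1.ge]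
    have ha' : 0 ≤ a' := by rcases h' with h | h; exacts [h.1.le, h.1.ge]
    have h1 := mul_nonneg hl ha
    have h2 := mul_nonneg hl' ha'
    have e1 : l * a = 0 := by linarith
    have e2 : l' * a' = 0 := by linarith
    rw [hA, ← mul_assoc, ← mul_assoc, e1, e2]
    simp

theorem sum_mul_logb_convex {q f q' f' : C → ℝ} (h : ∀ c, relEntDom (q c) (f c))
    (h' : ∀ c, relEntDom (q' c) (f' c)) {l l' : ℝ} (hl : 0 ≤ l) (hl' : 0 ≤ l') :
    ∑ c, (l * q c + l' * q' c) *
        Real.logb 2 ((l * q c + l' * q' c) / (l * f c + l' * f' c))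
      ≤ l * ∑ c, q c * Real.logb 2 (q c / f c)
        + l' * ∑ c, q' c * Real.logb 2 (q' c / f' c) := by
  rw [Finset.mul_sum, Finset.mul_sum, ← Finset.sum_add_distrib]
  refine Finset.sum_le_sum fun c _ => ?_
  have h2 : 0 < Real.log 2 := Real.log_pos one_lt_two
  have := div_le_div_of_nonneg_right (mul_log_div_convex (h c) (h' c) hl hl') h2.le
  simp only [Real.logb]
  calc _ = _ := by ring
    _ ≤ _ := this
    _ = _ := by ring

/-- The program has a convex epigraph if its constraints are convex and the second argument of the
relative entropy is linear. -/
theorem convex_programEpigraph {I : Type*} {SΩ : Set (C → ℝ)} (hS : Convex ℝ SΩ) {α : ℝ}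
    (hα : 1 < α) {F : (I → ℝ) → Prop} (hF : Convex ℝ {y | F y}) {f : C → (I → ℝ) → ℝ}
    (hf : ∀ c y y' (l l' : ℝ), f c (l • y + l' • y') = l * f c y + l' * f c y') :
    Convex ℝ (programEpigraph SΩ α F f) := by
  have hr : 0 < 1 / (α - 1) := one_div_pos.2 (sub_pos.2 hα)
  rintro ⟨q, y, z⟩ ⟨hq, hy, hz⟩ ⟨q', y', z'⟩ ⟨hq', hy', hz'⟩ l l' hl hl' hll
  refine ⟨hS hq hq' hl hl' hll, hF hy hy' hl hl' hll, ?_⟩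
  obtain ⟨hd, hz⟩ := (mul_relEnt_le_iff hr _ _ _).1 hz
  obtain ⟨hd', hz'⟩ := (mul_relEnt_le_iff hr _ _ _).1 hz'
  refine (mul_relEnt_le_iff hr _ _ _).2 ⟨fun c => ?_, ?_⟩
  · have := relEntDom_convex (hd c) (hd' c) hl hl'
    simpa [hf] using this
  · have h1 := mul_le_mul_of_nonneg_left (sum_mul_logb_convex hd hd' hl hl') hr.le
    have h2 := mul_le_mul_of_nonneg_left hz hl
    have h3 := mul_le_mul_of_nonneg_left hz' hl'
    simp only [Prod.smul_mk, Prod.mk_add_mk, hf, Pi.add_apply, Pi.smul_apply, smul_eq_mul]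
    linarith

end RelEnt

/-! ### Comparison of the two infima and the theorem -/

section Value

variable {X Y A B C : Type*} [Fintype X] [Fintype Y] [Fintype A] [Fintype B] [Fintype C]
  [DecidableEq X] [DecidableEq Y] [DecidableEq A] [DecidableEq B] [DecidableEq C]

/-- Every NPA relaxation bounds the single-round value from below. -/
theorem NPARelaxation.programValue_le {S : Protocol X Y A B C} {SΩ : Set (C → ℝ)} {α : ℝ}
    (hα : α ∈ Set.Ioo (1 : ℝ) 2) {m : ℕ} (hm : 1 ≤ m) {nd w : Fin m → ℝ}
    (h : IsGaussRadauJacobi α m nd w) (R : NPARelaxation S α nd w) :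
    programValue SΩ α (fun y : R.Idx → ℝ => y R.one = 1 ∧ (R.momentMatrix y).PosSemidef)
      (fun c y => R.riesz y (objective S α nd w c)) ≤ singleRoundValue S SΩ α := by
  have hr : 0 ≤ 1 / (α - 1) := one_div_nonneg.2 (sub_nonneg.2 hα.1.le)
  refine le_iInf fun dA => le_iInf fun dB => le_iInf fun dE => le_iInf fun D => le_iInf fun q =>
    le_iInf fun hq => le_iInf fun σ => le_iInf fun hσ => ?_
  obtain ⟨Z, hZ⟩ := exists_petz_le_expect D hσ.1 hα hm h
  -- The feasible point keeps q and takes the moments of the strategy with the operators Z.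
  refine iInf₂_le_of_le q hq (iInf₂_le_of_le (R.moments D Z σ)
    ⟨R.moments_one D Z σ hσ, R.posSemidef_momentMatrix_moments D Z σ hσ.1⟩ ?_)
  refine mul_le_mul_of_nonneg_left (relEnt_anti fun c => ?_) (EReal.coe_nonneg.2 hr)
  change D.petz σ α c ≤ R.riesz (R.moments D Z σ) (objective S α nd w c)
  rw [R.riesz_moments D Z σ (R.objective_mono c)]
  exact hZ c

end Value

end DIRenyi

end

open DIRenyi in
theorem theorem6 {X Y A B C : Type*} [Fintype X] [Fintype Y] [Fintype A] [Fintype B] [Fintype C]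
    [DecidableEq X] [DecidableEq Y] [DecidableEq A] [DecidableEq B] [DecidableEq C]
    (S : Protocol X Y A B C) (SΩ : Set (C → ℝ)) (hΩ : SΩ ⊆ stdSimplex ℝ C)
    (α : ℝ) (hα : α ∈ Set.Ioo (1 : ℝ) 2) (m : ℕ) (hm : 1 ≤ m) :
    ∃ nd w : Fin m → ℝ, IsGaussRadauJacobi α m nd w ∧
      ∀ R : NPARelaxation S α nd w,
        ∃ (a : R.Idx → C → ℝ) (E : R.Idx → Matrix R.Row R.Row ℝ),
          (∀ (y : R.Idx → ℝ) (c : C), ∑ i, a i c * y i = R.riesz y (objective S α nd w c)) ∧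
          (∀ y : R.Idx → ℝ, R.momentMatrix y = ∑ i, y i • E i) ∧
          programValue SΩ α
              (fun y : R.Idx → ℝ => y R.one = 1 ∧ (∑ i, y i • E i).PosSemidef)
              (fun c y => ∑ i, a i c * y i)
            ≤ singleRoundValue S SΩ α ∧
          (Convex ℝ SΩ →
            Convex ℝ (programEpigraph SΩ α
              (fun y : R.Idx → ℝ => y R.one = 1 ∧ (∑ i, y i • E i).PosSemidef)
              (fun c y => ∑ i, a i c * y i))) := by
  obtain ⟨nd, w, h⟩ := GaussRadau.exists_isGaussRadauJacobi hα hm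
  refine ⟨nd, w, h, fun R => ⟨fun i c => (objective S α nd w c).coeff i.1, R.coeffMatrix,
    fun y c => rfl, R.momentMatrix_eq_sum, ?_, fun hS => ?_⟩⟩
  · simp only [← R.momentMatrix_eq_sum]
    exact R.programValue_le hα hm h
  · refine convex_programEpigraph hS hα.1 ?_ fun c y y' l l' => ?_
    · rintro y ⟨hy, hp⟩ y' ⟨hy', hp'⟩ l l' hl hl' hll
      refine ⟨by simp [hy, hy', hll], ?_⟩
      have : ∑ i, (l • y + l' • y') i • R.coeffMatrix i
          = l • ∑ i, y i • R.coeffMatrix i + l' • ∑ i, y' i • R.coeffMatrix i := by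
        simp [Finset.smul_sum, add_smul, mul_smul, Finset.sum_add_distrib]
      rw [this]
      exact (hp.smul hl).add (hp'.smul hl')
    · simp only [Pi.add_apply, Pi.smul_apply, smul_eq_mul, mul_add, Finset.sum_add_distrib,
        Finset.mul_sum]
      congr 1 <;> exact Finset.sum_congr rfl fun i _ => by ring
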